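/- A random multisubset of $(0,1]$ is a random at most countable multiset $A$ of elements of $(0,1]$ with finite multiplicities, such that $|A\cap S|$ (counted with multiplicities, possibly infinite) is a random variable for every Borel set $S$. Its ranked sequence $L=(L_1,L_2,\dots)$ lists the elements of $A$ in decreasing order, with repetitions, padded with $0$'s if $A$ is finite. For $\theta>0$, the Poisson–Dirichlet distribution $\mathrm{PD}(\theta)$ is the law of the decreasing rearrangement of $G_1=1-V_1$, $G_2=V_1(1-V_2)$, $G_3=V_1V_2(1-V_3),\dots$, where $V_i=U_i^{1/\theta}$ and $U_1,U_2,\dots$ are independent and uniform on $(0,1)$. **Lemma.** Let $\theta>0$, let $A_1,A_2,\dots$ be random multisubsets of $(0,1]$ (possibly on different probability spaces), with ranked sequences $L(1),L(2),\dots$, and let $T_n$ be the sum of the elements of $A_n$, counted with multiplicities. Suppose that $\mathbb{P}(T_n\le 1)=1$ for every $n$, and that there are real numbers $\alpha,\beta$ with $\alpha+\beta=1-\theta$ such that, for every $k\ge 1$ and all pairwise disjoint closed intervals $I_i=[a_i,b_i]\subset(0,1]$, $i=1,\dots,k$, with $b_1+\cdots+b_k<1$, $$\liminf_{n\to\infty}\mathbb{E}\prod_{i=1}^k|A_n\cap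 I_i|\ \ge\ \frac{\theta^k}{(1-a_1-\cdots-a_k)^{\alpha}(1-b_1-\cdots-b_k)^{\beta}}\prod_{i=1}^k\frac{b_i-a_i}{b_i}.\qquad(*)$$ Then $L(n)$ converges in distribution to $\mathrm{PD}(\theta)$ as $n\to\infty$ (as random elements of $\mathbb{R}^{\mathbb{N}}$ with the product topology). The same conclusion holds if in place of $(*)$ one assumes, for all such $k$ and intervals, $$\liminf_{n\to\infty}\mathbb{E}\prod_{i=1}^k|A_n\cap I_i|\ \ge\ \frac{\theta^k}{(1-a_1-\cdots-a_k)^{\alpha}(1-b_1-\cdots-b_k)^{\beta}}\prod_{i=1}^k\log\frac{b_i}{a_i}.$$ -/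

import Mathlib

open MeasureTheory ProbabilityTheory Filter Topology
open scoped ENNReal

/-- An at most countable multisubset of `(0,1]` all of whose multiplicities are finite:
`mult x` is the multiplicity of `x` (and is `0` when `x` is not an element). -/
structure UnitMultiset where
  mult : ℝ → ℕ
  support_subset : Function.support mult ⊆ Set.Ioc 0 1
  countable_support : (Function.support mult).Countable

namespace UnitMultiset

/-- `|A ∩ S|`, counted with multiplicities, possibly infinite. -/
noncomputable def count (A : UnitMultiset) (S : Set ℝ) : ℝ≥0∞ :=
  ∑' x : S, (A.mult x : ℝ≥0∞)

/-- The sum of the elements of `A`, counted with multiplicities, possibly infinite. -/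
noncomputable def sum (A : UnitMultiset) : ℝ≥0∞ :=
  ∑' x : ℝ, (A.mult x : ℝ≥0∞) * ENNReal.ofReal x

/-- The elements of `A` ranked by decreasing size, with repetitions, padded with zeros.
The term of index `i` (from `0`) is the largest `x > 0` such that at least `i + 1` elements of `A`,
counted with multiplicities, are `≥ x`, and it is `0` if `A` has at most `i` elements.
(The supremum is attained as soon as `A.sum` is finite.) -/
noncomputable def ranked (A : UnitMultiset) (i : ℕ) : ℝ :=
  sSup {x : ℝ | 0 < x ∧ (i : ℝ≥0∞) + 1 ≤ A.count (Set.Ici x)}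

/-- The σ-algebra generated by the counts `|A ∩ S|`, `S` Borel. A random multisubset of `(0,1]` is a
measurable map from a probability space to `UnitMultiset`. -/
noncomputable instance : MeasurableSpace UnitMultiset :=
  ⨆ S : {S : Set ℝ // MeasurableSet S},
    MeasurableSpace.comap (fun A : UnitMultiset => A.count S.1) inferInstance

end UnitMultiset

/-- The terms of a sequence of nonnegative reals ranked by decreasing size, with repetitions: the
term of index `i` (from `0`) is the largest `x > 0` such that at least `i + 1` terms of `g` are
`≥ x`, and it is `0` if there is no such `x`. -/
noncomputable def rankedSeq (g : ℕ → ℝ) (i : ℕ) : ℝ :=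
  sSup {x : ℝ | 0 < x ∧ ((i + 1 : ℕ) : ℕ∞) ≤ {j : ℕ | x ≤ g j}.encard}

/-- The stick-breaking sequence `1 - V₀, V₀ (1 - V₁), V₀ V₁ (1 - V₂), …` with `Vⱼ = uⱼ ^ (1 / θ)`. -/
noncomputable def gemSeq (θ : ℝ) (u : ℕ → ℝ) (i : ℕ) : ℝ :=
  (∏ j ∈ Finset.range i, u j ^ (1 / θ)) * (1 - u i ^ (1 / θ))

/-- The law of a sequence of independent random variables uniformly distributed on `(0,1)`. -/
noncomputable def uniformSeqLaw : Measure (ℕ → ℝ) :=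
  Measure.infinitePi (fun _ : ℕ => (volume : Measure ℝ).restrict (Set.Ioo 0 1))

/-- The Poisson-Dirichlet distribution with parameter `θ`: the law of the ranked
`GEM(θ)` sequence. -/
noncomputable def poissonDirichlet (θ : ℝ) : Measure (ℕ → ℝ) :=
  uniformSeqLaw.map (fun u => rankedSeq (gemSeq θ u))

instance isProbabilityMeasure_uniformSeqLaw : IsProbabilityMeasure uniformSeqLaw := by
  have : IsProbabilityMeasure ((volume : Measure ℝ).restrict (Set.Ioo 0 1)) := ⟨by simp⟩
  unfold uniformSeqLaw
  infer_instance

theorem measurable_gemSeq (θ : ℝ) : Measurable (gemSeq θ) := by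
  refine measurable_pi_lambda _ fun i => ?_
  unfold gemSeq
  fun_prop

theorem measurable_rankedSeq : Measurable rankedSeq := by
  refine measurable_pi_lambda _ fun i => ?_
  have hS : ∀ x : ℝ, MeasurableSet
      {g : ℕ → ℝ | ((i + 1 : ℕ) : ℕ∞) ≤ {j : ℕ | x ≤ g j}.encard} := by
    intro x
    have : {g : ℕ → ℝ | ((i + 1 : ℕ) : ℕ∞) ≤ {j : ℕ | x ≤ g j}.encard} =
        ⋃ t ∈ {t : Finset ℕ | t.card = i + 1}, ⋂ j ∈ t, {g : ℕ → ℝ | x ≤ g j} := by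
      ext g
      simp only [Set.mem_ofPred_eq, Set.mem_iUnion, Set.mem_iInter, exists_prop]
      constructor
      · intro h
        obtain ⟨t, ht, hc⟩ := Set.exists_subset_encard_eq h
        have hf : t.Finite := Set.finite_of_encard_eq_coe hc
        refine ⟨hf.toFinset, ?_, fun j hj => ht (by simpa using hj)⟩
        rw [hf.encard_eq_coe_toFinset_card] at hc
        exact_mod_cast hc
      · rintro ⟨t, hc, ht⟩
        rw [← hc, ← Set.encard_coe_eq_coe_finsetCard]
        exact Set.encard_le_encard fun j hj => ht j (by simpa using hj)
    rw [this]
    refine MeasurableSet.biUnion (Set.to_countable _) fun t _ => ?_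
    exact Finset.measurableSet_biInter t fun j _ =>
      measurableSet_le measurable_const (measurable_pi_apply j)
  have hmono : ∀ (g : ℕ → ℝ) (x y : ℝ), x ≤ y →
      ((i + 1 : ℕ) : ℕ∞) ≤ {j : ℕ | y ≤ g j}.encard →
      ((i + 1 : ℕ) : ℕ∞) ≤ {j : ℕ | x ≤ g j}.encard := fun g x y hxy h =>
    h.trans (Set.encard_le_encard fun j hj => le_trans hxy hj)
  refine measurable_of_Ioi fun y => ?_
  rcases lt_or_ge y 0 with hy | hy
  · have : (fun g : ℕ → ℝ => rankedSeq g i) ⁻¹' Set.Ioi y = Set.univ := by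
      ext g
      simp only [Set.mem_preimage, Set.mem_Ioi, Set.mem_univ, iff_true]
      exact lt_of_lt_of_le hy (Real.sSup_nonneg fun x hx => hx.1.le)
    rw [this]
    exact MeasurableSet.univ
  · have : (fun g : ℕ → ℝ => rankedSeq g i) ⁻¹' Set.Ioi y =
        (⋃ N : ℕ, {g : ℕ → ℝ |
          ((i + 1 : ℕ) : ℕ∞) ≤ {j : ℕ | ((N : ℝ) + 1) ≤ g j}.encard}ᶜ) ∩
        (⋃ q ∈ {q : ℚ | y < q}, {g : ℕ → ℝ |
          ((i + 1 : ℕ) : ℕ∞) ≤ {j : ℕ | (q : ℝ) ≤ g j}.encard}) := by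
      ext g
      simp only [Set.mem_preimage, Set.mem_Ioi, Set.mem_inter_iff, Set.mem_iUnion,
        Set.mem_compl_iff, Set.mem_ofPred_eq, exists_prop]
      constructor
      · intro h
        have hne : {x : ℝ | 0 < x ∧
            ((i + 1 : ℕ) : ℕ∞) ≤ {j : ℕ | x ≤ g j}.encard}.Nonempty := by
          by_contra hne
          rw [Set.not_nonempty_iff_eq_empty] at hne
          rw [rankedSeq, hne, Real.sSup_empty] at h
          exact absurd h (not_lt.2 hy)
        constructor
        · by_contra! hN
          have hb : ¬ BddAbove {x : ℝ | 0 < x ∧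
              ((i + 1 : ℕ) : ℕ∞) ≤ {j : ℕ | x ≤ g j}.encard} := by
            rintro ⟨M, hM⟩
            obtain ⟨N, hN'⟩ := exists_nat_gt M
            have := hM (show ((N : ℝ) + 1) ∈ _ from ⟨by positivity, hN N⟩)
            linarith
          rw [rankedSeq, Real.sSup_of_not_bddAbove hb] at h
          exact absurd h (not_lt.2 hy)
        · obtain ⟨x, hx, hyx⟩ := exists_lt_of_lt_csSup hne h
          obtain ⟨q, hq1, hq2⟩ := exists_rat_btwn hyx
          exact ⟨q, hq1, hmono g _ _ hq2.le hx.2⟩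
      · rintro ⟨⟨N, hN⟩, q, hq, hg⟩
        refine lt_of_lt_of_le hq (le_csSup ⟨(N : ℝ) + 1, ?_⟩ ⟨lt_of_le_of_lt hy hq, hg⟩)
        intro x hx
        by_contra! hlt
        exact hN (hmono g _ _ hlt.le hx.2)
    rw [this]
    exact (MeasurableSet.iUnion fun N => (hS _).compl).inter
      (MeasurableSet.biUnion (Set.to_countable _) fun q _ => hS _)

instance isProbabilityMeasure_poissonDirichlet (θ : ℝ) :
    IsProbabilityMeasure (poissonDirichlet θ) :=
  Measure.isProbabilityMeasure_map
    (measurable_rankedSeq.comp (measurable_gemSeq θ)).aemeasurable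

/-! By the portmanteau theorem it is enough to show PD(θ)(G) ≤ liminf P(L(n) ∈ G) for every open G,
which is why lower bounds on the intensities suffice. The link with the stick-breaking sequence is
size-biased sampling without replacement: drawing elements one after another, each with probability
its size over 1 minus the sum already drawn, gives a k-tuple x the weight ∏ xᵢ / (1 - x₁ - ⋯ -
xᵢ₋₁). If the multiset has sum at most 1, these weights add up to at most 1
(`sum_sizeBiased_weights_le_one`).

Take a grid of small mesh and keep only the k-tuples of distinct cells that force the ranking into G
as soon as the multiset meets all of them. The weighted number of tuples of elements in the kept
cells is then at most the indicator of {ranking ∈ G} (`sum_weight_mul_lintegral_le`). Taking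
expectations and inserting the hypothesis bounds liminf P(L(n) ∈ G) below by a Riemann sum: the
factors xᵢ of the weights cancel the 1 / bᵢ, the powers combine through α + β = 1 - θ, and what
remains is θ^k (1 - ∑ xᵢ)^(θ - 1) ∏ (1 - x₁ - ⋯ - xᵢ₋₁)⁻¹. This is exactly the joint density of the
first k stick pieces (`uniformSeqLaw_map_gemSeq`).

Fatou's lemma is then applied as the mesh tends to 0 and again as k → ∞. The second limit loses
nothing because the pieces almost surely sum to 1: a long initial segment leaves so little mass that
it determines the ranking up to a small error (`eventually_ranked_mem`). The logarithmic hypothesis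
implies the other one, since 1 - a/b ≤ log (b/a). -/

namespace UnitMultiset

/-! ### Counts and ranked sequences of multisets -/

theorem sum_mult_le_count (A : UnitMultiset) {S : Set ℝ} (F : Finset ℝ) (hF : ∀ x ∈ F, x ∈ S) :
    ∑ x ∈ F, (A.mult x : ℝ≥0∞) ≤ A.count S := by
  rw [count, tsum_subtype S (fun x => (A.mult x : ℝ≥0∞))]
  refine le_trans (le_of_eq (Finset.sum_congr rfl fun x hx => ?_)) (ENNReal.sum_le_tsum F)
  rw [Set.indicator_of_mem (hF x hx)]

theorem exists_mem_of_count_ne_zero {A : UnitMultiset} {S : Set ℝ} (h : A.count S ≠ 0) :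
    ∃ x ∈ S, A.mult x ≠ 0 := by
  by_contra! hc
  refine h ?_
  rw [count, ENNReal.tsum_eq_zero]
  intro x
  simp [hc x x.2]

theorem mem_Ioc_of_mult_ne_zero {A : UnitMultiset} {x : ℝ} (h : A.mult x ≠ 0) :
    x ∈ Set.Ioc (0 : ℝ) 1 :=
  A.support_subset h

/-- Without this bound the supremum defining `ranked` could be the default value 0. -/
theorem bddAbove_ranked (A : UnitMultiset) (i : ℕ) :
    BddAbove {x : ℝ | 0 < x ∧ (i : ℝ≥0∞) + 1 ≤ A.count (Set.Ici x)} := by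
  refine ⟨1, fun x hx => ?_⟩
  have h0 : A.count (Set.Ici x) ≠ 0 := fun h0 => by
    have := hx.2
    rw [h0] at this
    simp at this
  obtain ⟨y, hy, hm⟩ := exists_mem_of_count_ne_zero h0
  exact le_trans hy (mem_Ioc_of_mult_ne_zero hm).2

theorem le_ranked {A : UnitMultiset} {i : ℕ} {s : ℝ} (hs : 0 < s)
    (h : (i : ℝ≥0∞) + 1 ≤ A.count (Set.Ici s)) : s ≤ A.ranked i :=
  le_csSup (A.bddAbove_ranked i) ⟨hs, h⟩

theorem ranked_nonneg (A : UnitMultiset) (i : ℕ) : 0 ≤ A.ranked i :=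
  Real.sSup_nonneg fun _ hx => hx.1.le

theorem count_mono (A : UnitMultiset) {S T : Set ℝ} (h : S ⊆ T) : A.count S ≤ A.count T := by
  rw [count, count, tsum_subtype S (fun x => (A.mult x : ℝ≥0∞)),
    tsum_subtype T (fun x => (A.mult x : ℝ≥0∞))]
  exact ENNReal.tsum_le_tsum fun x => Set.indicator_le_indicator_of_subset h (by simp) x

/-- Counts decrease with the level, so rational levels suffice; this is what makes `ranked`
measurable. For negative `y` the equivalence could fail, since the supremum of an empty set is 0. -/
theorem lt_ranked_iff (A : UnitMultiset) (i : ℕ) {y : ℝ} (hy : 0 ≤ y) :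
    y < A.ranked i ↔ ∃ q : ℚ, y < q ∧ (i : ℝ≥0∞) + 1 ≤ A.count (Set.Ici (q : ℝ)) := by
  constructor
  · intro h
    have hne : {x : ℝ | 0 < x ∧ (i : ℝ≥0∞) + 1 ≤ A.count (Set.Ici x)}.Nonempty := by
      by_contra hne
      rw [Set.not_nonempty_iff_eq_empty] at hne
      rw [ranked, hne, Real.sSup_empty] at h
      exact absurd h (not_lt.2 hy)
    obtain ⟨x, hx, hyx⟩ := exists_lt_of_lt_csSup hne h
    obtain ⟨q, hq1, hq2⟩ := exists_rat_btwn hyx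
    exact ⟨q, hq1, hx.2.trans (A.count_mono (Set.Ici_subset_Ici.2 hq2.le))⟩
  · rintro ⟨q, hq, h⟩
    exact hq.trans_le (le_ranked (hy.trans_lt hq) h)

theorem measurable_count {S : Set ℝ} (hS : MeasurableSet S) :
    Measurable fun A : UnitMultiset => A.count S := by
  rw [measurable_iff_comap_le]
  exact le_iSup (fun S : {S : Set ℝ // MeasurableSet S} =>
    MeasurableSpace.comap (fun A : UnitMultiset => A.count S.1) inferInstance) ⟨S, hS⟩

theorem measurable_ranked : Measurable ranked := by
  refine measurable_pi_lambda _ fun i => measurable_of_Ioi fun y => ?_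
  rcases lt_or_ge y 0 with hy | hy
  · have : (fun A : UnitMultiset => A.ranked i) ⁻¹' Set.Ioi y = Set.univ :=
      Set.eq_univ_of_forall fun A => hy.trans_le (A.ranked_nonneg i)
    rw [this]
    exact MeasurableSet.univ
  · have : (fun A : UnitMultiset => A.ranked i) ⁻¹' Set.Ioi y =
        ⋃ q ∈ {q : ℚ | y < q}, {A : UnitMultiset | (i : ℝ≥0∞) + 1 ≤ A.count (Set.Ici (q : ℝ))} := by
      ext A
      simpa using A.lt_ranked_iff i hy
    rw [this]
    exact MeasurableSet.biUnion (Set.to_countable _) fun q _ =>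
      measurableSet_le measurable_const (measurable_count measurableSet_Ici)

/-! ### Elements that almost exhaust the sum determine the ranking -/

/-- An element of a multiset of sum at most `1`, beyond a given set of elements, is at most what
that set leaves over. -/
theorem le_one_sub_sum_of_lt_mult {A : UnitMultiset} (hA : A.sum ≤ 1) {X : Finset ℝ}
    (hX : ∀ x ∈ X, A.mult x ≠ 0) {y : ℝ} (hy : (if y ∈ X then 1 else 0) < A.mult y) :
    y ≤ 1 - ∑ x ∈ X, x := by
  classical
  have hy0 : A.mult y ≠ 0 := by omega
  have hpos : ∀ x ∈ X, 0 ≤ x := fun x hx => (mem_Ioc_of_mult_ne_zero (hX x hx)).1.le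
  -- Each element of `X` is counted once and `y` once more, so `y` has weight 2 if it already lies
  -- in `X`; the true multiplicities dominate these weights.
  have h1 : ∑ x ∈ insert y X, (((if x ∈ X then 1 else 0) + (if x = y then 1 else 0) : ℕ) : ℝ≥0∞) *
      ENNReal.ofReal x ≤ 1 := by
    refine le_trans (le_trans (Finset.sum_le_sum fun x hx => ?_)
      (ENNReal.sum_le_tsum (insert y X))) hA
    gcongr
    by_cases hxy : x = y
    · subst hxy
      simp only [if_true]
      omega
    · have hxX : x ∈ X := (Finset.mem_insert.1 hx).resolve_left hxy
      simp only [hxX, hxy, if_true, if_false]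
      exact Nat.one_le_iff_ne_zero.2 (hX x hxX)
  have h2 : ∑ x ∈ insert y X, (((if x ∈ X then 1 else 0) + (if x = y then 1 else 0) : ℕ) : ℝ≥0∞) *
      ENNReal.ofReal x = ENNReal.ofReal (∑ x ∈ X, x + y) := by
    rw [ENNReal.ofReal_add (Finset.sum_nonneg hpos) (mem_Ioc_of_mult_ne_zero hy0).1.le,
      ENNReal.ofReal_sum_of_nonneg hpos]
    simp only [Nat.cast_add, Nat.cast_ite, Nat.cast_one, Nat.cast_zero, add_mul, ite_mul, one_mul,
      zero_mul, Finset.sum_add_distrib]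
    congr 1
    · rw [← Finset.sum_filter]
      congr 1
      ext x
      simp only [Finset.mem_filter, Finset.mem_insert]
      tauto
    · simp
  rw [h2, ENNReal.ofReal_le_one] at h1
  linarith

/-- If `x₁, …, xₖ` are elements of `A` that almost exhaust the sum, then above a small level there
are no other elements. -/
theorem count_Ici_le_card {A : UnitMultiset} (hA : A.sum ≤ 1) {k : ℕ} {x : Fin k → ℝ}
    (hinj : Function.Injective x) (hx : ∀ l, A.mult (x l) ≠ 0) {s : ℝ} (hs : 1 - ∑ l, x l < s) :
    A.count (Set.Ici s) ≤ ({l : Fin k | s ≤ x l} : Set (Fin k)).ncard := by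
  classical
  set X : Finset ℝ := Finset.univ.image x with hXdef
  have hX : ∀ y ∈ X, A.mult y ≠ 0 := by
    intro y hy
    obtain ⟨l, -, rfl⟩ := Finset.mem_image.1 hy
    exact hx l
  have hsum : ∑ y ∈ X, y = ∑ l, x l := Finset.sum_image fun a _ b _ h => hinj h
  have hle : ∀ y, s ≤ y → A.mult y ≤ if y ∈ X then 1 else 0 := by
    intro y hy
    by_contra! hc
    have := le_one_sub_sum_of_lt_mult hA hX hc
    rw [hsum] at this
    linarith
  rw [count, tsum_subtype (Set.Ici s) (fun x => (A.mult x : ℝ≥0∞)),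
    tsum_eq_sum (s := X.filter (s ≤ ·))]
  · calc ∑ y ∈ X.filter (s ≤ ·), (Set.Ici s).indicator (fun x => (A.mult x : ℝ≥0∞)) y
        ≤ ∑ y ∈ X.filter (s ≤ ·), (1 : ℝ≥0∞) := by
          refine Finset.sum_le_sum fun y hy => ?_
          obtain ⟨hy1, hy2⟩ := Finset.mem_filter.1 hy
          rw [Set.indicator_of_mem (Set.mem_Ici.2 hy2)]
          have := hle y hy2
          rw [if_pos hy1] at this
          exact_mod_cast this
      _ = ((X.filter (s ≤ ·)).card : ℝ≥0∞) := by simp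
      _ = _ := by
          congr 1
          rw [Set.ncard_eq_toFinset_card', hXdef, Finset.filter_image,
            Finset.card_image_of_injective _ hinj]
          congr 1
          ext l
          simp
  · intro y hy
    by_cases hys : s ≤ y
    · rw [Set.indicator_of_mem (Set.mem_Ici.2 hys)]
      have hyX : y ∉ X := fun h => hy (Finset.mem_filter.2 ⟨h, hys⟩)
      have := hle y hys
      rw [if_neg hyX] at this
      simpa using this
    · rw [Set.indicator_of_notMem (by simpa using hys)]

theorem card_le_count_Ici {A : UnitMultiset} {k : ℕ} {x : Fin k → ℝ}
    (hinj : Function.Injective x) (hx : ∀ l, A.mult (x l) ≠ 0) (s : ℝ) :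
    (({l : Fin k | s ≤ x l} : Set (Fin k)).ncard : ℝ≥0∞) ≤ A.count (Set.Ici s) := by
  classical
  refine le_trans ?_ (A.sum_mult_le_count ((Finset.univ.filter (s ≤ x ·)).image x) ?_)
  · rw [Finset.sum_image fun a _ b _ h => hinj h, Set.ncard_eq_toFinset_card']
    have : ({l : Fin k | s ≤ x l} : Set (Fin k)).toFinset = Finset.univ.filter (s ≤ x ·) := by
      ext l
      simp
    rw [this, Finset.card_eq_sum_ones, Nat.cast_sum]
    refine Finset.sum_le_sum fun l _ => ?_
    exact_mod_cast Nat.one_le_iff_ne_zero.2 (hx l)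
  · intro y hy
    obtain ⟨l, hl, rfl⟩ := Finset.mem_image.1 hy
    exact (Finset.mem_filter.1 hl).2

end UnitMultiset

theorem rankedSeq_nonneg (g : ℕ → ℝ) (i : ℕ) : 0 ≤ rankedSeq g i :=
  Real.sSup_nonneg fun _ hx => hx.1.le

theorem le_rankedSeq {g : ℕ → ℝ} (hg : ∀ j, g j ≤ 1) {i : ℕ} {s : ℝ} (hs : 0 < s)
    (h : ((i + 1 : ℕ) : ℕ∞) ≤ {j : ℕ | s ≤ g j}.encard) : s ≤ rankedSeq g i := by
  refine le_csSup ⟨1, fun x hx => ?_⟩ ⟨hs, h⟩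
  have hne : {j : ℕ | x ≤ g j}.Nonempty := by
    rw [← Set.encard_ne_zero]
    intro h0
    have := hx.2
    rw [h0] at this
    simp at this
  obtain ⟨j, hj⟩ := hne
  exact le_trans hj (hg j)

/-- The ranked sequence of a multiset of sum at most `1` is close to the ranked sequence of `g` when
the multiset has elements close to the first terms of `g` that almost exhaust the sum. -/
theorem abs_ranked_sub_rankedSeq_le {A : UnitMultiset} (hA : A.sum ≤ 1) {g : ℕ → ℝ}
    (hg : ∀ j, g j ≤ 1) {k : ℕ} {x : Fin k → ℝ} (hinj : Function.Injective x)
    (hx : ∀ l, A.mult (x l) ≠ 0) {ε η : ℝ} (hε : 0 < ε) (hη : 0 ≤ η)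
    (hclose : ∀ l, |x l - g l| ≤ η) (hsum : 1 - ε < ∑ l, x l) (htail : ∀ j, k ≤ j → g j < ε)
    (i : ℕ) : |A.ranked i - rankedSeq g i| ≤ ε + η := by
  rw [abs_sub_le_iff]
  constructor
  · have hr := rankedSeq_nonneg g i
    suffices A.ranked i ≤ rankedSeq g i + (ε + η) by linarith
    -- The bound is checked level by level; its nonnegativity covers an empty set of levels.
    refine Real.sSup_le (fun s hs => ?_) (by linarith)
    by_contra! hlt
    have h1 : s - η ≤ rankedSeq g i := by
      refine le_rankedSeq hg (by linarith) ?_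
      -- Here `s > ε > 1 - ∑ l, x l`, so all elements of size at least `s` are among the `x l`.
      have h2 := hs.2.trans (UnitMultiset.count_Ici_le_card hA hinj hx (s := s) (by linarith))
      have h3 : i + 1 ≤ ({l : Fin k | s ≤ x l} : Set (Fin k)).ncard := by exact_mod_cast h2
      have h4 : ((i + 1 : ℕ) : ℕ∞) ≤ ({l : Fin k | s ≤ x l} : Set (Fin k)).encard := by
        rw [← Set.Finite.cast_ncard_eq (Set.toFinite _)]
        exact_mod_cast h3
      rw [← (Fin.val_injective (n := k)).encard_image] at h4
      refine h4.trans (Set.encard_le_encard ?_)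
      rintro _ ⟨l, hl, rfl⟩
      have := (abs_le.1 (hclose l)).2
      have hl' : s ≤ x l := hl
      change s - η ≤ g l
      linarith
    linarith
  · have hr := A.ranked_nonneg i
    suffices rankedSeq g i ≤ A.ranked i + (ε + η) by linarith
    refine Real.sSup_le (fun s hs => ?_) (by linarith)
    by_contra! hlt
    have h1 : s - η ≤ A.ranked i := by
      refine UnitMultiset.le_ranked (by linarith) ?_
      refine le_trans ?_ (UnitMultiset.card_le_count_Ici hinj hx (s - η))
      have h4 : ((i + 1 : ℕ) : ℕ∞) ≤ ({l : Fin k | s - η ≤ x l} : Set (Fin k)).encard := by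
        rw [← (Fin.val_injective (n := k)).encard_image]
        refine hs.2.trans (Set.encard_le_encard fun j hj => ?_)
        have hj' : s ≤ g j := hj
        -- Terms of index at least `k` are below `ε`, hence below `s`.
        have hjk : j < k := by
          by_contra! hc
          have := htail j hc
          linarith
        refine ⟨⟨j, hjk⟩, ?_, rfl⟩
        have := (abs_le.1 (hclose ⟨j, hjk⟩)).1
        change s - η ≤ x ⟨j, hjk⟩
        simp only at this
        linarith
      rw [← Set.Finite.cast_ncard_eq (Set.toFinite _)] at h4
      have h5 : i + 1 ≤ ({l : Fin k | s - η ≤ x l} : Set (Fin k)).ncard := by exact_mod_cast h4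
      exact_mod_cast h5
    linarith

/-! ### Size-biased sampling without replacement -/

/-- The sum of the entries of `x` that precede the entry of index `i`. -/
noncomputable def precedingSum {k : ℕ} (x : Fin k → ℝ) (i : Fin k) : ℝ :=
  ∑ l, if l < i then x l else 0

theorem precedingSum_castSucc {k : ℕ} (x : Fin (k + 1) → ℝ) (i : Fin k) :
    precedingSum x i.castSucc = precedingSum (fun l => x l.castSucc) i := by
  simp [precedingSum, Fin.sum_univ_castSucc, Fin.castSucc_lt_castSucc_iff, (Fin.le_last _).not_gt]

theorem precedingSum_last {k : ℕ} (x : Fin (k + 1) → ℝ) :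
    precedingSum x (Fin.last k) = ∑ l : Fin k, x l.castSucc := by
  simp [precedingSum, Fin.sum_univ_castSucc, Fin.castSucc_lt_last]

/-- The weights of size-biased sampling without replacement have total mass at most `1`. -/
theorem sum_sizeBiased_weights_le_one {ι : Type*} [Fintype ι] [DecidableEq ι] (c : ι → ℝ≥0∞)
    (a : ι → ℝ) (ha : ∀ j, 0 ≤ a j) (hc : ∀ j, c j ≠ 0 → 1 ≤ c j)
    (hsum : ∑ j, c j * ENNReal.ofReal (a j) ≤ 1) (k : ℕ) :
    ∑ t : Fin k → ι, (if Function.Injective t then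
      ∏ i, (c (t i) * ENNReal.ofReal (a (t i) / (1 - precedingSum (a ∘ t) i))) else 0) ≤ 1 := by
  induction k with
  | zero => simp [Function.injective_of_subsingleton]
  | succ k ih =>
    refine le_trans ?_ ih
    -- The last draw is summed first: given the earlier draws `t`, its weights should total at most
    -- 1.
    rw [← (Fin.snocEquiv fun _ => ι).sum_comp, Fintype.sum_prod_type_right]
    refine Finset.sum_le_sum fun t _ => ?_
    have hinj : ∀ j : ι, Function.Injective ((Fin.snocEquiv fun _ => ι) (j, t)) ↔
        Function.Injective t ∧ ∀ l, t l ≠ j := by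
      intro j
      change Function.Injective (Fin.snoc (α := fun _ => ι) t j) ↔ _
      rw [Fin.snoc_injective_iff]
      simp
    have hcast : ∀ (j : ι) (l : Fin k), (Fin.snocEquiv fun _ => ι) (j, t) l.castSucc = t l :=
      fun j l => Fin.snoc_castSucc (α := fun _ => ι) _ _ _
    have hlast : ∀ j : ι, (Fin.snocEquiv fun _ => ι) (j, t) (Fin.last k) = j :=
      fun j => Fin.snoc_last (α := fun _ => ι) _ _
    simp only [hinj, Fin.prod_univ_castSucc, precedingSum_castSucc, precedingSum_last,
      Function.comp_apply, hcast, hlast]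
    by_cases ht : Function.Injective t
    swap
    · simp [ht]
    simp only [ht, true_and, if_true]
    set p : ℝ≥0∞ := ∏ i, c (t i) * ENNReal.ofReal
      (a (t i) / (1 - precedingSum (fun l => a (t l)) i)) with hp
    -- An empty drawn cell kills the product; otherwise every drawn cell has `c (t l) ≥ 1`.
    by_cases hz : ∃ l, c (t l) = 0
    · obtain ⟨l, hl⟩ := hz
      have : p = 0 := Finset.prod_eq_zero (Finset.mem_univ l) (by simp [hl])
      simp [this]
    push Not at hz
    set r : ℝ := 1 - ∑ l, a (t l) with hr
    have key : ∑ j, (if ∀ l, t l ≠ j then c j * ENNReal.ofReal (a j / r) else 0) ≤ 1 := by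
      -- If nothing is left over, `ENNReal.ofReal` truncates the weights to 0 (division by 0 also
      -- gives 0).
      rcases le_or_gt r 0 with hr0 | hr0
      · refine le_of_eq_of_le (Finset.sum_eq_zero fun j _ => ?_) zero_le_one
        rw [ENNReal.ofReal_of_nonpos (div_nonpos_of_nonneg_of_nonpos (ha j) hr0)]
        simp
      -- The drawn cells, being distinct and nonempty, already use up at least `∑ l, a (t l)` of the
      -- total mass 1.
      have h1 : ∑ j, (if ∀ l, t l ≠ j then c j * ENNReal.ofReal (a j) else 0) +
          ∑ l, ENNReal.ofReal (a (t l)) ≤ 1 := by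
        refine le_trans ?_ hsum
        rw [← Finset.sum_filter, ← Finset.sum_filter_add_sum_filter_not Finset.univ
          (fun j => ∀ l, t l ≠ j) (fun j => c j * ENNReal.ofReal (a j))]
        gcongr
        have : (Finset.univ.filter fun j => ¬ ∀ l, t l ≠ j) = Finset.univ.image t := by
          ext j
          simp
        rw [this, Finset.sum_image fun x _ y _ h => ht h]
        refine Finset.sum_le_sum fun l _ => ?_
        exact le_mul_of_one_le_left (zero_le) (hc _ (hz l))
      rw [← ENNReal.ofReal_sum_of_nonneg fun l _ => ha (t l)] at h1
      have h2 : ∑ j, (if ∀ l, t l ≠ j then c j * ENNReal.ofReal (a j) else 0) ≤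
          ENNReal.ofReal r := by
        rw [hr, ENNReal.ofReal_sub _ (Finset.sum_nonneg fun l _ => ha (t l)), ENNReal.ofReal_one]
        exact ENNReal.le_sub_of_add_le_right ENNReal.ofReal_ne_top h1
      have h3 : ∑ j, (if ∀ l, t l ≠ j then c j * ENNReal.ofReal (a j / r) else 0) =
          (∑ j, (if ∀ l, t l ≠ j then c j * ENNReal.ofReal (a j) else 0)) / ENNReal.ofReal r := by
        rw [div_eq_mul_inv, Finset.sum_mul]
        refine Finset.sum_congr rfl fun j _ => ?_
        rw [ENNReal.ofReal_div_of_pos hr0]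
        split_ifs
        · rw [div_eq_mul_inv, mul_assoc]
        · simp
      rw [h3]
      exact ENNReal.div_le_of_le_mul (by simpa using h2)
    calc _ = p * ∑ j, (if ∀ l, t l ≠ j then c j * ENNReal.ofReal (a j / r) else 0) := by
          rw [Finset.mul_sum]
          refine Finset.sum_congr rfl fun j _ => ?_
          rw [mul_ite, mul_zero]
      _ ≤ p * 1 := by gcongr
      _ = p := mul_one p

namespace UnitMultiset

/-- An element lies in at most one cell and is at least that cell's `a i`, so replacing elements by
these values only lowers the sum. -/
theorem sum_count_mul_le_sum (A : UnitMultiset) {ι : Type*} [Fintype ι] {S : ι → Set ℝ}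
    {a : ι → ℝ} (hS : Pairwise fun i j => Disjoint (S i) (S j)) (ha : ∀ i, ∀ x ∈ S i, a i ≤ x) :
    ∑ i, A.count (S i) * ENNReal.ofReal (a i) ≤ A.sum := by
  classical
  calc ∑ i, A.count (S i) * ENNReal.ofReal (a i)
      ≤ ∑ i, ∑' x, (S i).indicator (fun x => (A.mult x : ℝ≥0∞) * ENNReal.ofReal x) x := by
        refine Finset.sum_le_sum fun i _ => ?_
        rw [count, tsum_subtype (S i) (fun x => (A.mult x : ℝ≥0∞)), ← ENNReal.tsum_mul_right]
        refine ENNReal.tsum_le_tsum fun x => ?_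
        by_cases hx : x ∈ S i
        · rw [Set.indicator_of_mem hx, Set.indicator_of_mem hx]
          gcongr
          exact ha i x hx
        · simp [hx]
    _ = ∑' x, ∑ i, (S i).indicator (fun x => (A.mult x : ℝ≥0∞) * ENNReal.ofReal x) x :=
        (Summable.tsum_finsetSum fun i _ => ENNReal.summable).symm
    _ ≤ A.sum := by
        refine ENNReal.tsum_le_tsum fun x => ?_
        by_cases hx : ∃ i, x ∈ S i
        · obtain ⟨i, hi⟩ := hx
          rw [Finset.sum_eq_single i]
          · rw [Set.indicator_of_mem hi]
          · intro j _ hj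
            exact Set.indicator_of_notMem (fun h => (hS hj).le_bot ⟨h, hi⟩) _
          · simp
        · push Not at hx
          rw [Finset.sum_eq_zero fun i _ => Set.indicator_of_notMem (hx i) _]
          exact zero_le

theorem one_le_count {A : UnitMultiset} {S : Set ℝ} (h : A.count S ≠ 0) : 1 ≤ A.count S := by
  obtain ⟨x, hx, hm⟩ := exists_mem_of_count_ne_zero h
  refine le_trans ?_ (A.sum_mult_le_count {x} (by simpa using hx))
  simpa using Nat.one_le_iff_ne_zero.2 hm

/-- The size-biased weights of a multiset of sum at most `1`, gathered by disjoint cells. -/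
theorem sum_prod_count_mul_weights_le_one {A : UnitMultiset} (hA : A.sum ≤ 1) {ι : Type*}
    [Fintype ι] [DecidableEq ι] {S : ι → Set ℝ} {a : ι → ℝ}
    (hS : Pairwise fun i j => Disjoint (S i) (S j)) (ha : ∀ i, ∀ x ∈ S i, a i ≤ x)
    (ha0 : ∀ i, 0 ≤ a i) {k : ℕ} {J : Finset (Fin k → ι)} (hJ : ∀ t ∈ J, Function.Injective t) :
    ∑ t ∈ J, (∏ i, ENNReal.ofReal (a (t i) / (1 - precedingSum (a ∘ t) i))) *
      ∏ i, A.count (S (t i)) ≤ 1 := by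
  refine le_trans ?_ (sum_sizeBiased_weights_le_one (fun i => A.count (S i)) a ha0
    (fun j => one_le_count) ((A.sum_count_mul_le_sum hS ha).trans hA) k)
  refine le_trans (Finset.sum_le_sum fun t ht => ?_)
    (Finset.sum_le_sum_of_subset (Finset.subset_univ J))
  rw [if_pos (hJ t ht), Finset.prod_mul_distrib, mul_comm]

end UnitMultiset

/-! ### The law of the stick-breaking sequence -/

/-- The density of the first `k` terms of the stick-breaking sequence. -/
noncomputable def gemDensity (θ : ℝ) (k : ℕ) : (Fin k → ℝ) → ℝ≥0∞ :=
  Set.indicator {x | (∀ i, 0 < x i) ∧ ∑ i, x i < 1} fun x =>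
    ENNReal.ofReal (θ ^ k * (1 - ∑ i, x i) ^ (θ - 1) * ∏ i, (1 - precedingSum x i)⁻¹)

theorem measurable_precedingSum {k : ℕ} (i : Fin k) :
    Measurable fun x : Fin k → ℝ => precedingSum x i := by
  refine Finset.measurable_fun_sum _ fun l _ => ?_
  split_ifs
  · exact measurable_pi_apply l
  · exact measurable_const

theorem measurable_gemDensity (θ : ℝ) (k : ℕ) : Measurable (gemDensity θ k) := by
  refine Measurable.indicator ?_ ?_
  · have h2 : ∀ i : Fin k, Measurable fun x : Fin k → ℝ => precedingSum x i :=
      measurable_precedingSum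
    fun_prop
  · have h1 : {x : Fin k → ℝ | (∀ i, 0 < x i) ∧ ∑ i, x i < 1} =
        (⋂ i, {x | 0 < x i}) ∩ {x | ∑ i, x i < 1} := by
      ext x
      simp
    rw [h1]
    exact (MeasurableSet.iInter fun i => measurableSet_lt measurable_const
      (measurable_pi_apply i)).inter (measurableSet_lt (by fun_prop) measurable_const)

/-- The law of a stick piece broken off a stick of length `r`. -/
theorem lintegral_stick_piece {θ : ℝ} (hθ : 0 < θ) {r : ℝ} (hr : 0 < r) (ψ : ℝ → ℝ≥0∞) :
    ∫⁻ u in Set.Ioo (0 : ℝ) 1, ψ (r * (1 - u ^ (1 / θ))) =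
      ∫⁻ y in Set.Ioo 0 r, ENNReal.ofReal (θ * (1 - y / r) ^ (θ - 1) / r) * ψ y := by
  have hbase : ∀ y ∈ Set.Ioo 0 r, 0 < 1 - y / r ∧ 1 - y / r < 1 := by
    intro y hy
    have h1 : y / r < 1 := (div_lt_one hr).2 hy.2
    have h2 : 0 < y / r := div_pos hy.1 hr
    constructor <;> linarith
  have hback : ∀ y ∈ Set.Ioo 0 r, r * (1 - ((1 - y / r) ^ θ) ^ (1 / θ)) = y := by
    intro y hy
    rw [← Real.rpow_mul (hbase y hy).1.le, mul_one_div_cancel hθ.ne', Real.rpow_one]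
    field_simp
    ring
  -- Change of variables `u = (1 - y / r) ^ θ`, the inverse of `y = r * (1 - u ^ (1 / θ))`.
  have himage : (fun y => (1 - y / r) ^ θ) '' Set.Ioo 0 r = Set.Ioo 0 1 := by
    ext u
    constructor
    · rintro ⟨y, hy, rfl⟩
      exact ⟨Real.rpow_pos_of_pos (hbase y hy).1 _,
        Real.rpow_lt_one (hbase y hy).1.le (hbase y hy).2 hθ⟩
    · intro hu
      have h1 : 0 < u ^ (1 / θ) := Real.rpow_pos_of_pos hu.1 _
      have h2 : u ^ (1 / θ) < 1 := Real.rpow_lt_one hu.1.le hu.2 (by positivity)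
      refine ⟨r * (1 - u ^ (1 / θ)), ⟨by nlinarith, by nlinarith⟩, ?_⟩
      have : 1 - r * (1 - u ^ (1 / θ)) / r = u ^ (1 / θ) := by
        field_simp
        ring
      simp only [this]
      rw [← Real.rpow_mul hu.1.le, one_div_mul_cancel hθ.ne', Real.rpow_one]
  have hderiv : ∀ y ∈ Set.Ioo 0 r, HasDerivWithinAt (fun y => (1 - y / r) ^ θ)
      (-(1 / r) * θ * (1 - y / r) ^ (θ - 1)) (Set.Ioo 0 r) y := by
    intro y hy
    have h1 : HasDerivAt (fun y : ℝ => 1 - y / r) (-(1 / r)) y :=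
      ((hasDerivAt_id y).div_const r).const_sub 1
    exact (h1.rpow_const (Or.inl (hbase y hy).1.ne')).hasDerivWithinAt
  have hinj : Set.InjOn (fun y => (1 - y / r) ^ θ) (Set.Ioo 0 r) := by
    intro y hy z hz h
    rw [← hback y hy, ← hback z hz]
    have h' : (1 - y / r) ^ θ = (1 - z / r) ^ θ := h
    rw [h']
  rw [← himage, lintegral_image_eq_lintegral_abs_deriv_mul measurableSet_Ioo hderiv hinj]
  refine setLIntegral_congr_fun measurableSet_Ioo fun y hy => ?_
  rw [hback y hy]
  congr 2
  have : 0 < (1 - y / r) ^ (θ - 1) := Real.rpow_pos_of_pos (hbase y hy).1 _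
  rw [show -(1 / r) * θ * (1 - y / r) ^ (θ - 1) = -(θ * (1 - y / r) ^ (θ - 1) / r) by ring, abs_neg,
    abs_of_pos (by positivity)]

theorem precedingSum_le_sum {k : ℕ} {x : Fin k → ℝ} (hx : ∀ i, 0 ≤ x i) (i : Fin k) :
    precedingSum x i ≤ ∑ l, x l := by
  refine Finset.sum_le_sum fun l _ => ?_
  split_ifs
  · exact le_rfl
  · exact hx l

/-- Given the first `k` pieces, the next one is broken off a stick of length `r = 1 - ∑ i, x i`. Its
density carries `(1 - y / r) ^ (θ - 1)`, whose denominator `r ^ (θ - 1)` cancels the power in the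
density of the first `k` pieces. -/
theorem gemDensity_snoc {θ : ℝ} (hθ : 0 < θ) (k : ℕ) (x : Fin k → ℝ) (y : ℝ) :
    gemDensity θ (k + 1) (Fin.snoc (α := fun _ => ℝ) x y) = gemDensity θ k x *
      (Set.Ioo 0 (1 - ∑ i, x i)).indicator (fun y => ENNReal.ofReal
        (θ * (1 - y / (1 - ∑ i, x i)) ^ (θ - 1) / (1 - ∑ i, x i))) y := by
  have hiff : (Fin.snoc (α := fun _ => ℝ) x y) ∈
      {x : Fin (k + 1) → ℝ | (∀ i, 0 < x i) ∧ ∑ i, x i < 1} ↔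
      x ∈ {x : Fin k → ℝ | (∀ i, 0 < x i) ∧ ∑ i, x i < 1} ∧ y ∈ Set.Ioo 0 (1 - ∑ i, x i) := by
    simp only [Set.mem_ofPred_eq, Fin.forall_fin_succ', Fin.snoc_castSucc, Fin.snoc_last,
      Fin.sum_univ_castSucc, Set.mem_Ioo]
    constructor
    · rintro ⟨⟨h1, h2⟩, h3⟩
      exact ⟨⟨h1, by linarith⟩, h2, by linarith⟩
    · rintro ⟨⟨h1, h2⟩, h3, h4⟩
      exact ⟨⟨h1, h3⟩, by linarith⟩
  rw [gemDensity, gemDensity]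
  by_cases hx : x ∈ {x : Fin k → ℝ | (∀ i, 0 < x i) ∧ ∑ i, x i < 1}
  swap
  · rw [Set.indicator_of_notMem (fun h => hx (hiff.1 h).1), Set.indicator_of_notMem hx, zero_mul]
  by_cases hy : y ∈ Set.Ioo 0 (1 - ∑ i, x i)
  swap
  · rw [Set.indicator_of_notMem (fun h => hy (hiff.1 h).2), Set.indicator_of_notMem hy, mul_zero]
  rw [Set.indicator_of_mem (hiff.2 ⟨hx, hy⟩), Set.indicator_of_mem hx, Set.indicator_of_mem hy]
  have hr : 0 < 1 - ∑ i, x i := by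
    have := hx.2
    linarith
  have hpre : ∀ i, 0 < 1 - precedingSum x i := fun i => by
    have := precedingSum_le_sum (fun i => (hx.1 i).le) i
    linarith
  have hprod : 0 ≤ ∏ i, (1 - precedingSum x i)⁻¹ :=
    Finset.prod_nonneg fun i _ => (inv_pos.2 (hpre i)).le
  have hsub : 1 - y / (1 - ∑ i, x i) = (1 - (∑ i, x i + y)) / (1 - ∑ i, x i) := by
    field_simp
    ring
  rw [← ENNReal.ofReal_mul' ?_]
  · congr 1
    simp only [Fin.prod_univ_castSucc, precedingSum_castSucc, precedingSum_last, Fin.snoc_castSucc,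
      Fin.snoc_last, Fin.sum_univ_castSucc]
    rw [hsub, Real.div_rpow (by linarith [hy.2]) hr.le]
    have : (1 - ∑ i, x i) ^ (θ - 1) ≠ 0 := (Real.rpow_pos_of_pos hr _).ne'
    field_simp
    ring
  · exact div_nonneg (mul_nonneg hθ.le (Real.rpow_nonneg (by
      rw [hsub]
      exact div_nonneg (by linarith [hy.2]) hr.le) _)) hr.le

/-- The product is the length left after `k` breaks, and the pieces telescope. -/
theorem sum_gemSeq (θ : ℝ) (u : ℕ → ℝ) (k : ℕ) :
    ∑ i : Fin k, gemSeq θ u i = 1 - ∏ j ∈ Finset.range k, u j ^ (1 / θ) := by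
  rw [Fin.sum_univ_eq_sum_range (fun i => gemSeq θ u i)]
  induction k with
  | zero => simp
  | succ k ih =>
    rw [Finset.sum_range_succ, ih, Finset.prod_range_succ, gemSeq]
    ring

theorem gemSeq_congr (θ : ℝ) {u v : ℕ → ℝ} {i : ℕ} (h : ∀ j ≤ i, u j = v j) :
    gemSeq θ u i = gemSeq θ v i := by
  rw [gemSeq, gemSeq, h i le_rfl]
  congr 1
  exact Finset.prod_congr rfl fun j hj => by rw [h j (Finset.mem_range.1 hj).le]

theorem iIndepFun_uniformSeqLaw : iIndepFun (fun (i : ℕ) (u : ℕ → ℝ) => u i) uniformSeqLaw := by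
  have : IsProbabilityMeasure ((volume : Measure ℝ).restrict (Set.Ioo 0 1)) := ⟨by simp⟩
  exact iIndepFun_infinitePi (P := fun _ : ℕ => (volume : Measure ℝ).restrict (Set.Ioo 0 1))
    (X := fun _ x => x) fun _ => measurable_id

theorem uniformSeqLaw_map_eval (i : ℕ) :
    uniformSeqLaw.map (fun u => u i) = (volume : Measure ℝ).restrict (Set.Ioo 0 1) := by
  have : IsProbabilityMeasure ((volume : Measure ℝ).restrict (Set.Ioo 0 1)) := ⟨by simp⟩
  exact Measure.infinitePi_map_eval (fun _ : ℕ => (volume : Measure ℝ).restrict (Set.Ioo 0 1)) i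

theorem measurable_gemSeq_fin (θ : ℝ) (k : ℕ) :
    Measurable fun (u : ℕ → ℝ) (i : Fin k) => gemSeq θ u i :=
  measurable_pi_lambda _ fun i => (measurable_pi_apply (i : ℕ)).comp (measurable_gemSeq θ)

theorem indepFun_gemSeq_next (θ : ℝ) (k : ℕ) :
    IndepFun (fun (u : ℕ → ℝ) (i : Fin k) => gemSeq θ u i) (fun u => u k) uniformSeqLaw := by
  have h := iIndepFun_uniformSeqLaw.indepFun_finset (Finset.range k) {k} (by simp)
    fun i => measurable_pi_apply i
  -- The first `k` coordinates are extended by 0 to a full sequence; the first `k` pieces do not see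
  -- the extension.
  have hext : Measurable fun (w : Finset.range k → ℝ) (j : ℕ) =>
      if h : j ∈ Finset.range k then w ⟨j, h⟩ else 0 := by
    refine measurable_pi_lambda _ fun j => ?_
    split_ifs
    · exact measurable_pi_apply _
    · exact measurable_const
  have h2 := h.comp ((measurable_gemSeq_fin θ k).comp hext)
    (measurable_pi_apply (⟨k, by simp⟩ : ({k} : Finset ℕ)))
  refine h2.congr (.of_forall fun u => ?_) (.of_forall fun u => rfl)
  ext i
  refine Eq.symm ?_
  refine gemSeq_congr θ fun j hj => ?_
  have : j < k := hj.trans_lt i.2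
  simp [this]

/-- The law of the first terms of the stick-breaking sequence. -/
theorem uniformSeqLaw_map_gemSeq {θ : ℝ} (hθ : 0 < θ) (k : ℕ) :
    uniformSeqLaw.map (fun u (i : Fin k) => gemSeq θ u i) =
      volume.withDensity (gemDensity θ k) := by
  induction k with
  | zero =>
    refine Measure.ext_of_lintegral _ fun ψ hψ => ?_
    rw [lintegral_map hψ (measurable_gemSeq_fin θ 0),
      lintegral_withDensity_eq_lintegral_mul _ (measurable_gemDensity θ 0) hψ]
    have h1 : ∀ x : Fin 0 → ℝ, ψ x = ψ 0 := fun x => by rw [Subsingleton.elim x 0]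
    have h2 : ∀ x : Fin 0 → ℝ, gemDensity θ 0 x = 1 := fun x => by
      rw [gemDensity, Set.indicator_of_mem (by simp)]
      simp
    simp [h1, h2, volume_pi]
  | succ k ih =>
    have hX := measurable_gemSeq_fin θ k
    refine Measure.ext_of_lintegral _ fun ψ hψ => ?_
    have hsnoc : Measurable fun p : (Fin k → ℝ) × ℝ => Fin.snoc (α := fun _ => ℝ) p.1 p.2 := by
      refine measurable_pi_lambda _ fun i => ?_
      refine Fin.lastCases ?_ (fun i => ?_) i
      · simpa using measurable_snd
      · simpa using! (measurable_pi_apply i).comp measurable_fst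
    have hψ' : Measurable fun p : (Fin k → ℝ) × ℝ =>
        ψ (Fin.snoc (α := fun _ => ℝ) p.1 ((1 - ∑ i, p.1 i) * (1 - p.2 ^ (1 / θ)))) := by
      refine hψ.comp (hsnoc.comp (f := fun p : (Fin k → ℝ) × ℝ =>
        (p.1, (1 - ∑ i, p.1 i) * (1 - p.2 ^ (1 / θ)))) ?_)
      fun_prop
    -- The new piece is the fraction `1 - u k ^ (1 / θ)` of what the first `k` pieces leave.
    have hsplit : ∀ u : ℕ → ℝ, (fun i : Fin (k + 1) => gemSeq θ u i) =
        Fin.snoc (α := fun _ => ℝ) (fun i : Fin k => gemSeq θ u i)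
          ((1 - ∑ i : Fin k, gemSeq θ u i) * (1 - u k ^ (1 / θ))) := by
      intro u
      ext i
      refine Fin.lastCases ?_ (fun i => ?_) i
      · rw [Fin.snoc_last, sum_gemSeq, gemSeq]
        simp
      · simp
    calc ∫⁻ x, ψ x ∂uniformSeqLaw.map (fun u (i : Fin (k + 1)) => gemSeq θ u i)
        = ∫⁻ u, ψ (Fin.snoc (α := fun _ => ℝ) (fun i : Fin k => gemSeq θ u i)
            ((1 - ∑ i : Fin k, gemSeq θ u i) * (1 - u k ^ (1 / θ)))) ∂uniformSeqLaw := by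
          rw [lintegral_map hψ (measurable_gemSeq_fin θ (k + 1))]
          simp_rw [hsplit]
      _ = ∫⁻ p, ψ (Fin.snoc (α := fun _ => ℝ) p.1 ((1 - ∑ i, p.1 i) * (1 - p.2 ^ (1 / θ))))
            ∂(volume.withDensity (gemDensity θ k)).prod
              ((volume : Measure ℝ).restrict (Set.Ioo 0 1)) := by
          rw [← ih, ← uniformSeqLaw_map_eval k,
            ← (indepFun_iff_map_prod_eq_prod_map_map hX.aemeasurable
              (measurable_pi_apply k).aemeasurable).1 (indepFun_gemSeq_next θ k),
            lintegral_map hψ' (hX.prodMk (measurable_pi_apply k))]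
      _ = ∫⁻ x, gemDensity θ k x * ∫⁻ t in Set.Ioo (0 : ℝ) 1,
            ψ (Fin.snoc (α := fun _ => ℝ) x ((1 - ∑ i, x i) * (1 - t ^ (1 / θ)))) := by
          rw [lintegral_prod _ hψ'.aemeasurable, lintegral_withDensity_eq_lintegral_mul _
            (measurable_gemDensity θ k) hψ'.lintegral_prod_right']
          rfl
      _ = ∫⁻ x : Fin k → ℝ, ∫⁻ y : ℝ, gemDensity θ (k + 1) (Fin.snoc (α := fun _ => ℝ) x y) *
            ψ (Fin.snoc (α := fun _ => ℝ) x y) := by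
          refine lintegral_congr fun x => ?_
          by_cases hx : x ∈ {x : Fin k → ℝ | (∀ i, 0 < x i) ∧ ∑ i, x i < 1}
          swap
          · have h0 : gemDensity θ k x = 0 := Set.indicator_of_notMem hx _
            simp [gemDensity_snoc hθ, h0]
          rw [lintegral_stick_piece hθ (r := 1 - ∑ i, x i) (by linarith [hx.2])
            (fun y => ψ (Fin.snoc (α := fun _ => ℝ) x y)), ← lintegral_indicator measurableSet_Ioo,
            ← lintegral_const_mul']
          · refine lintegral_congr fun y => ?_
            rw [gemDensity_snoc hθ, mul_assoc, Set.indicator_mul_left]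
          · rw [gemDensity]
            rw [Set.indicator_of_mem hx]
            exact ENNReal.ofReal_ne_top
      _ = ∫⁻ z, gemDensity θ (k + 1) z * ψ z := by
          have hm : Measurable fun z => gemDensity θ (k + 1) z * ψ z :=
            (measurable_gemDensity θ (k + 1)).mul hψ
          rw [← ((volume_preserving_piFinSuccAbove (fun _ : Fin (k + 1) => ℝ)
            (Fin.last k)).symm).lintegral_comp hm, Measure.volume_eq_prod, lintegral_prod_symm']
          · refine lintegral_congr fun x => lintegral_congr fun y => ?_
            have : (MeasurableEquiv.piFinSuccAbove (fun _ : Fin (k + 1) => ℝ) (Fin.last k)).symm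
                (y, x) = Fin.snoc (α := fun _ => ℝ) x y := Fin.insertNth_last' y x
            rw [this]
          · exact hm.comp (MeasurableEquiv.measurable _)
      _ = ∫⁻ z, ψ z ∂volume.withDensity (gemDensity θ (k + 1)) := by
          rw [lintegral_withDensity_eq_lintegral_mul _ (measurable_gemDensity θ (k + 1)) hψ]
          rfl

/-! ### Almost sure properties of the stick-breaking sequence -/

theorem ae_uniformSeqLaw_mem_Ioo : ∀ᵐ u ∂uniformSeqLaw, ∀ j, u j ∈ Set.Ioo (0 : ℝ) 1 := by
  rw [ae_all_iff]
  intro j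
  refine ae_of_ae_map (μ := uniformSeqLaw) (f := fun u => u j) (p := (· ∈ Set.Ioo (0 : ℝ) 1))
    (measurable_pi_apply j).aemeasurable ?_
  rw [uniformSeqLaw_map_eval]
  exact ae_restrict_mem measurableSet_Ioo

/-- By independence the products have expectation `c ^ k`, where `c < 1` is the mean of one factor.
These expectations are summable, so the series of products is almost surely finite and its terms
tend to 0. -/
theorem ae_tendsto_prod_rpow {θ : ℝ} (hθ : 0 < θ) : ∀ᵐ u ∂uniformSeqLaw,
    Tendsto (fun k => ∏ j ∈ Finset.range k, u j ^ (1 / θ)) atTop (𝓝 0) := by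
  set c : ℝ≥0∞ := ∫⁻ t in Set.Ioo (0 : ℝ) 1, ENNReal.ofReal (t ^ (1 / θ)) with hc
  have hmeas : Measurable fun t : ℝ => ENNReal.ofReal (t ^ (1 / θ)) := by fun_prop
  have hc1 : c < 1 := by
    have hle : c ≤ 1 := by
      calc c ≤ ∫⁻ t in Set.Ioo (0 : ℝ) 1, 1 := by
            refine setLIntegral_mono measurable_const fun t ht => ?_
            rw [ENNReal.ofReal_le_one]
            exact Real.rpow_le_one ht.1.le ht.2.le (by positivity)
        _ = 1 := by simp
    have : c < ∫⁻ t in Set.Ioo (0 : ℝ) 1, 1 := by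
      refine lintegral_strict_mono ?_ aemeasurable_const (hle.trans_lt ENNReal.one_lt_top).ne ?_
      · simp [Measure.restrict_eq_zero]
      · refine (ae_restrict_mem measurableSet_Ioo).mono fun t ht => ?_
        rw [ENNReal.ofReal_lt_one]
        exact Real.rpow_lt_one ht.1.le ht.2 (by positivity)
    simpa using this
  have hind : iIndepFun (fun (j : ℕ) (u : ℕ → ℝ) => ENNReal.ofReal (u j ^ (1 / θ)))
      uniformSeqLaw :=
    iIndepFun_uniformSeqLaw.comp (fun _ t => ENNReal.ofReal (t ^ (1 / θ))) fun _ => hmeas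
  have hint : ∀ k, ∫⁻ u, ∏ j ∈ Finset.range k, ENNReal.ofReal (u j ^ (1 / θ)) ∂uniformSeqLaw =
      c ^ k := by
    intro k
    rw [lintegral_prod_eq_prod_lintegral_of_indepFun _ _ hind
      fun j => hmeas.comp (measurable_pi_apply j)]
    have hj : ∀ j : ℕ, ∫⁻ u, ENNReal.ofReal (u j ^ (1 / θ)) ∂uniformSeqLaw = c := fun j => by
      rw [hc, ← uniformSeqLaw_map_eval j, lintegral_map hmeas (measurable_pi_apply j)]
    rw [Finset.prod_congr rfl fun j _ => hj j, Finset.prod_const, Finset.card_range]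
  have hmeasP : ∀ k, Measurable fun u : ℕ → ℝ =>
      ∏ j ∈ Finset.range k, ENNReal.ofReal (u j ^ (1 / θ)) := fun k =>
    Finset.measurable_fun_prod _ fun j _ => hmeas.comp (measurable_pi_apply j)
  have hfin : ∫⁻ u, ∑' k, ∏ j ∈ Finset.range k, ENNReal.ofReal (u j ^ (1 / θ)) ∂uniformSeqLaw ≠
      ∞ := by
    rw [lintegral_tsum fun k => (hmeasP k).aemeasurable]
    simp_rw [hint]
    rw [ENNReal.tsum_geometric]
    exact ENNReal.inv_ne_top.2 (tsub_pos_of_lt hc1).ne'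
  filter_upwards [ae_lt_top (Measurable.tsum hmeasP) hfin, ae_uniformSeqLaw_mem_Ioo] with u hu hmem
  have h0 := ENNReal.tendsto_atTop_zero_of_tsum_ne_top hu.ne
  rw [← ENNReal.tendsto_toReal_iff 
    (fun k => ENNReal.prod_ne_top fun j _ => ENNReal.ofReal_ne_top) (by simp)] at h0
  refine h0.congr fun k => ?_
  rw [← ENNReal.ofReal_prod_of_nonneg fun j _ => Real.rpow_nonneg (hmem j).1.le _,
    ENNReal.toReal_ofReal (Finset.prod_nonneg fun j _ => Real.rpow_nonneg (hmem j).1.le _)]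

/-- Finitely many terms have a law with a Lebesgue density, and the hyperplane where two coordinates
agree is null. -/
theorem ae_injective_gemSeq {θ : ℝ} (hθ : 0 < θ) :
    ∀ᵐ u ∂uniformSeqLaw, Function.Injective (gemSeq θ u) := by
  have h : ∀ i j : ℕ, i ≠ j → ∀ᵐ u ∂uniformSeqLaw, gemSeq θ u i ≠ gemSeq θ u j := by
    intro i j hij
    set k := max i j + 1 with hk
    let i' : Fin k := ⟨i, by omega⟩
    let j' : Fin k := ⟨j, by omega⟩
    have hne : i' ≠ j' := fun h => hij (by simpa [i', j'] using h)
    refine ae_of_ae_map (μ := uniformSeqLaw) (f := fun u (l : Fin k) => gemSeq θ u l)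
      (p := fun x => x i' ≠ x j') (measurable_gemSeq_fin θ k).aemeasurable ?_
    rw [uniformSeqLaw_map_gemSeq hθ]
    refine withDensity_absolutelyContinuous _ _ ?_
    let s : Submodule ℝ (Fin k → ℝ) := LinearMap.ker
      (LinearMap.proj (R := ℝ) (φ := fun _ : Fin k => ℝ) i' - LinearMap.proj j')
    have hs : s ≠ ⊤ := by
      intro htop
      have : Pi.single i' (1 : ℝ) ∈ s := htop ▸ Submodule.mem_top
      simp [s, hne.symm] at this
    refine measure_mono_null (fun x hx => ?_) (Measure.addHaar_submodule volume s hs)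
    simp only [Set.mem_compl_iff, Set.mem_ofPred_eq, not_not] at hx
    simp [s, hx]
  have h' : ∀ᵐ u ∂uniformSeqLaw, ∀ i j : ℕ, i ≠ j → gemSeq θ u i ≠ gemSeq θ u j := by
    simp only [ae_all_iff]
    exact h
  filter_upwards [h'] with u hu i j hij
  by_contra hne
  exact hu i j hne hij

/-- The almost sure properties of the stick-breaking sequence: its terms are positive and distinct,
and it sums up to `1` without exhausting the sum in finitely many terms. -/
theorem ae_gemSeq {θ : ℝ} (hθ : 0 < θ) : ∀ᵐ u ∂uniformSeqLaw,
    Function.Injective (gemSeq θ u) ∧ (∀ j, 0 < gemSeq θ u j) ∧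
      (∀ k, ∑ i : Fin k, gemSeq θ u i < 1) ∧
      Tendsto (fun k => ∑ i : Fin k, gemSeq θ u i) atTop (𝓝 1) := by
  filter_upwards [ae_injective_gemSeq hθ, ae_tendsto_prod_rpow hθ, ae_uniformSeqLaw_mem_Ioo]
    with u h1 h2 h3
  have hpos : ∀ k, 0 < ∏ j ∈ Finset.range k, u j ^ (1 / θ) := fun k =>
    Finset.prod_pos fun j _ => Real.rpow_pos_of_pos (h3 j).1 _
  refine ⟨h1, fun j => ?_, fun k => ?_, ?_⟩
  · refine mul_pos (hpos j) ?_
    have := Real.rpow_lt_one (h3 j).1.le (h3 j).2 (show 0 < 1 / θ by positivity)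
    linarith
  · rw [sum_gemSeq]
    linarith [hpos k]
  · simp_rw [sum_gemSeq]
    simpa using h2.const_sub 1

/-! ### Initial segments that force the ranking into an open set -/

/-- Near a point of an open set of sequences, in the uniform distance. -/
theorem exists_forall_abs_sub_le_mem {G : Set (ℕ → ℝ)} (hG : IsOpen G) {r : ℕ → ℝ} (hr : r ∈ G) :
    ∃ δ > 0, ∀ L : ℕ → ℝ, (∀ i, |L i - r i| < δ) → L ∈ G := by
  obtain ⟨I, v, hv, hsub⟩ := isOpen_pi_iff.1 hG r hr
  have h : ∀ i ∈ I, ∀ᶠ δ : ℝ in 𝓝[>] 0, Metric.ball (r i) δ ⊆ v i := by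
    intro i hi
    obtain ⟨δ, hδ, hball⟩ := Metric.isOpen_iff.1 (hv i hi).1 (r i) (hv i hi).2
    filter_upwards [Ioo_mem_nhdsGT hδ] with δ' hδ'
    exact (Metric.ball_subset_ball hδ'.2.le).trans hball
  obtain ⟨δ, hδ, hpos⟩ := (((Finset.eventually_all I).2 h).and self_mem_nhdsWithin).exists
  refine ⟨δ, hpos, fun L hL => hsub fun i hi => hδ i hi ?_⟩
  rw [Metric.mem_ball, Real.dist_eq]
  exact hL i

/-- If the ranking of `g` lies in an open set, then so does the ranking of every multiset of sum at
most `1` that has elements close to the terms of a long initial segment of `g`. -/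
theorem eventually_ranked_mem {G : Set (ℕ → ℝ)} (hG : IsOpen G) {g : ℕ → ℝ}
    (hpos : ∀ j, 0 < g j) (hlt : ∀ k, ∑ i : Fin k, g i < 1)
    (hlim : Tendsto (fun k => ∑ i : Fin k, g i) atTop (𝓝 1)) (hr : rankedSeq g ∈ G) :
    ∀ᶠ k in atTop, ∃ η > 0, ∀ (A : UnitMultiset) (x : Fin k → ℝ), A.sum ≤ 1 →
      Function.Injective x → (∀ l, A.mult (x l) ≠ 0) → (∀ l, |x l - g l| ≤ η) → A.ranked ∈ G := by
  obtain ⟨δ, hδ, hmem⟩ := exists_forall_abs_sub_le_mem hG hr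
  filter_upwards [hlim.eventually_const_lt (show 1 - δ / 4 < 1 by linarith)] with k hk
  have hlast : ∀ j, k ≤ j → g j < δ / 4 := by
    intro j hj
    have h1 := hlt (j + 1)
    rw [Fin.sum_univ_eq_sum_range, Finset.sum_range_succ] at h1
    rw [Fin.sum_univ_eq_sum_range] at hk
    have h2 : ∑ i ∈ Finset.range k, g i ≤ ∑ i ∈ Finset.range j, g i :=
      Finset.sum_le_sum_of_subset_of_nonneg (Finset.range_mono hj) fun i _ _ => (hpos i).le
    linarith
  have hg1 : ∀ j, g j ≤ 1 := by
    intro j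
    have h1 := hlt (j + 1)
    rw [Fin.sum_univ_eq_sum_range, Finset.sum_range_succ] at h1
    have h2 : 0 ≤ ∑ i ∈ Finset.range j, g i := Finset.sum_nonneg fun i _ => (hpos i).le
    linarith
  -- The `k` errors add up to at most `δ / 4`, so `∑ l, x l > 1 - δ / 2`; the comparison of rankings
  -- then gives a distance of at most `δ / 2 + δ / 4 < δ`.
  refine ⟨δ / 4 / (k + 1), by positivity, fun A x hA hinj hx hclose => hmem _ fun i => ?_⟩
  have hη : δ / 4 / (k + 1) ≤ δ / 4 :=
    div_le_self (by positivity) (by linarith [k.cast_nonneg (α := ℝ)])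
  have hsum : ∑ l : Fin k, g l - ∑ l, x l ≤ δ / 4 := by
    rw [← Finset.sum_sub_distrib]
    calc ∑ l : Fin k, (g l - x l) ≤ ∑ _l : Fin k, δ / 4 / (k + 1) :=
          Finset.sum_le_sum fun l _ => by linarith [(abs_le.1 (hclose l)).1]
      _ = k / (k + 1) * (δ / 4) := by
          rw [Finset.sum_const, Finset.card_univ, Fintype.card_fin, nsmul_eq_mul]
          ring
      _ ≤ 1 * (δ / 4) := by
          gcongr
          rw [div_le_one (by positivity)]
          linarith
      _ = δ / 4 := one_mul _
  have := abs_ranked_sub_rankedSeq_le hA hg1 hinj hx (ε := δ / 2) (by positivity)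
    (by positivity) hclose (by linarith) (fun j hj => by linarith [hlast j hj]) i
  linarith

/-! ### Grid cells and the bound for a fixed mesh -/

/-- The left endpoint of the cell of index `j` of the grid of mesh `1 / (N + 1)`. -/
noncomputable def gridLeft (N : ℕ) (j : Fin (N + 1)) : ℝ := (j : ℝ) / (N + 1)

/-- The right endpoint of the slightly shrunken cell of index `j` of the grid of mesh
`1 / (N + 1)`. -/
noncomputable def gridRight (N : ℕ) (j : Fin (N + 1)) : ℝ :=
  gridLeft N j + (N : ℝ) / (N + 1) / (N + 1)

theorem gridLeft_nonneg (N : ℕ) (j : Fin (N + 1)) : 0 ≤ gridLeft N j := by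
  unfold gridLeft
  positivity

theorem gridLeft_le_gridRight (N : ℕ) (j : Fin (N + 1)) : gridLeft N j ≤ gridRight N j := by
  unfold gridRight
  have : (0 : ℝ) ≤ (N : ℝ) / (N + 1) / (N + 1) := by positivity
  linarith

theorem gridRight_lt (N : ℕ) (j : Fin (N + 1)) : gridRight N j < gridLeft N j + 1 / (N + 1) := by
  unfold gridRight
  gcongr
  rw [div_lt_one (by positivity)]
  linarith

theorem gridRight_le_one (N : ℕ) (j : Fin (N + 1)) : gridRight N j ≤ 1 := by
  refine (gridRight_lt N j).le.trans ?_
  rw [gridLeft, ← add_div, div_le_one (by positivity)]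
  have : (j : ℕ) + 1 ≤ N + 1 := j.2
  exact_mod_cast this

/-- Adjacent closed cells of full width would share an endpoint. Shrinking separates them at the
cost of a factor `N / (N + 1)` per coordinate, which tends to 1. -/
theorem pairwise_disjoint_gridCells (N : ℕ) : Pairwise fun i j : Fin (N + 1) =>
    Disjoint (Set.Icc (gridLeft N i) (gridRight N i)) (Set.Icc (gridLeft N j) (gridRight N j)) := by
  have key : ∀ i j : Fin (N + 1), i < j → gridRight N i < gridLeft N j := by
    intro i j hij
    refine (gridRight_lt N i).trans_le ?_
    rw [gridLeft, gridLeft, ← add_div]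
    gcongr
    have : (i : ℕ) + 1 ≤ j := hij
    exact_mod_cast this
  intro i j hij
  rw [Set.disjoint_left]
  intro x hxi hxj
  rcases lt_or_gt_of_ne hij with h | h
  · linarith [key i j h, hxi.2, hxj.1]
  · linarith [key j i h, hxj.2, hxi.1]

/-- The tuples of distinct grid cells that force the ranking of a multiset of sum at most `1` that
meets all of them to lie in `G`. -/
noncomputable def forcingTuples (G : Set (ℕ → ℝ)) (k N : ℕ) : Finset (Fin k → Fin (N + 1)) :=
  open scoped Classical in
  Finset.univ.filter fun t => Function.Injective t ∧ (∀ i, 0 < gridLeft N (t i)) ∧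
    ∑ i, gridRight N (t i) < 1 ∧ ∀ A : UnitMultiset, A.sum ≤ 1 →
      (∀ i, A.count (Set.Icc (gridLeft N (t i)) (gridRight N (t i))) ≠ 0) → A.ranked ∈ G

theorem mem_forcingTuples {G : Set (ℕ → ℝ)} {k N : ℕ} {t : Fin k → Fin (N + 1)} :
    t ∈ forcingTuples G k N ↔ Function.Injective t ∧ (∀ i, 0 < gridLeft N (t i)) ∧
    ∑ i, gridRight N (t i) < 1 ∧ ∀ A : UnitMultiset, A.sum ≤ 1 →
      (∀ i, A.count (Set.Icc (gridLeft N (t i)) (gridRight N (t i))) ≠ 0) → A.ranked ∈ G := by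
  simp [forcingTuples]

/-- The size-biased weight of a tuple of grid cells. -/
noncomputable def tupleWeight {k N : ℕ} (t : Fin k → Fin (N + 1)) : ℝ≥0∞ :=
  ∏ i, ENNReal.ofReal (gridLeft N (t i) / (1 - precedingSum (gridLeft N ∘ t) i))

/-- Fatou's lemma for the measure with mass `w t` at each `t ∈ J`. -/
theorem sum_mul_liminf_le {ι : Type*} (J : Finset ι) [Finite ι] (w : ι → ℝ≥0∞)
    (f : ℕ → ι → ℝ≥0∞) : ∑ t ∈ J, w t * liminf (fun n => f n t) atTop ≤
      liminf (fun n => ∑ t ∈ J, w t * f n t) atTop := by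
  let _ : MeasurableSpace ι := ⊤
  have hdirac : ∀ h : ι → ℝ≥0∞, ∫⁻ t, h t ∂(∑ t ∈ J, w t • Measure.dirac t) =
      ∑ t ∈ J, w t * h t := by
    intro h
    simp [lintegral_finsetSum_measure, lintegral_smul_measure]
  simp_rw [← hdirac]
  exact lintegral_liminf_le fun n => measurable_from_top

/-- The sum of the size-biased weights of the tuples that force the ranking to lie in `G` is at most
the probability that it does. -/
theorem sum_weight_mul_lintegral_le {Ω : Type*} [MeasurableSpace Ω] {P : Measure Ω}
    {A : Ω → UnitMultiset} (hA : Measurable A) (hT : ∀ᵐ ω ∂P, (A ω).sum ≤ 1)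
    {G : Set (ℕ → ℝ)} (hG : IsOpen G) (k N : ℕ) :
    ∑ t ∈ forcingTuples G k N, tupleWeight t *
      ∫⁻ ω, ∏ i, (A ω).count (Set.Icc (gridLeft N (t i)) (gridRight N (t i))) ∂P ≤
      P {ω | (A ω).ranked ∈ G} := by
  have hcount : ∀ a b : ℝ, Measurable fun ω => (A ω).count (Set.Icc a b) := fun a b =>
    (UnitMultiset.measurable_count measurableSet_Icc).comp hA
  have hprod : ∀ t : Fin k → Fin (N + 1), Measurable fun ω =>
      ∏ i, (A ω).count (Set.Icc (gridLeft N (t i)) (gridRight N (t i))) := fun t =>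
    Finset.measurable_fun_prod _ fun i _ => hcount _ _
  have hmeas : MeasurableSet {ω | (A ω).ranked ∈ G} :=
    (UnitMultiset.measurable_ranked.comp hA) hG.measurableSet
  simp_rw [← lintegral_const_mul _ (hprod _)]
  rw [← lintegral_finsetSum _ fun t _ => (hprod t).const_mul _, ← lintegral_indicator_one hmeas]
  refine lintegral_mono_ae (hT.mono fun ω hω => ?_)
  -- On the event the size-biased weights total at most 1. Off it, the multiset misses a cell of
  -- each forcing tuple, so every product of counts vanishes.
  by_cases hmem : (A ω).ranked ∈ G
  · rw [Set.indicator_of_mem (show ω ∈ {ω | (A ω).ranked ∈ G} from hmem)]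
    exact UnitMultiset.sum_prod_count_mul_weights_le_one hω (pairwise_disjoint_gridCells N)
      (fun j x hx => hx.1) (gridLeft_nonneg N) fun t ht => (mem_forcingTuples.1 ht).1
  · rw [Set.indicator_of_notMem (show ω ∉ {ω | (A ω).ranked ∈ G} from hmem)]
    refine le_of_eq (Finset.sum_eq_zero fun t ht => ?_)
    rw [mul_eq_zero]
    right
    by_contra hne
    rw [← ne_eq, Finset.prod_ne_zero_iff] at hne
    exact hmem ((mem_forcingTuples.1 ht).2.2.2 _ hω fun i => hne i (Finset.mem_univ i))

/-! ### Step functions below the stick-breaking density -/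

/-- The lower bound for the expected number of tuples of elements in given intervals. -/
noncomputable def tupleBound (θ α β : ℝ) {k : ℕ} (a b : Fin k → ℝ) : ℝ :=
  θ ^ k / ((1 - ∑ i, a i) ^ α * (1 - ∑ i, b i) ^ β) * ∏ i, (b i - a i) / b i

/-- The step function that approximates the density of the stick-breaking sequence from below. -/
noncomputable def gridDensity (θ α β : ℝ) (G : Set (ℕ → ℝ)) (k N : ℕ) (x : Fin k → ℝ) : ℝ≥0∞ :=
  ∑ t ∈ forcingTuples G k N,
    (Set.univ.pi fun i => Set.Ico (gridLeft N (t i)) (gridLeft N (t i) + 1 / (N + 1))).indicator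
      (fun _ => tupleWeight t * ENNReal.ofReal (tupleBound θ α β (fun i => gridLeft N (t i))
        fun i => gridRight N (t i)) * ((N : ℝ≥0∞) + 1) ^ k) x

theorem measurable_gridDensity (θ α β : ℝ) (G : Set (ℕ → ℝ)) (k N : ℕ) :
    Measurable (gridDensity θ α β G k N) :=
  Finset.measurable_fun_sum _ fun _ _ => measurable_const.indicator
    (MeasurableSet.univ_pi fun _ => measurableSet_Ico)

/-- The full half-open cells have volume `(N + 1)⁻ᵏ`, which cancels the normalising factor in the
step function. -/
theorem lintegral_gridDensity (θ α β : ℝ) (G : Set (ℕ → ℝ)) (k N : ℕ) :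
    ∫⁻ x, gridDensity θ α β G k N x = ∑ t ∈ forcingTuples G k N, tupleWeight t *
      ENNReal.ofReal (tupleBound θ α β (fun i => gridLeft N (t i)) fun i => gridRight N (t i)) := by
  unfold gridDensity
  have hms : ∀ t : Fin k → Fin (N + 1), MeasurableSet (Set.univ.pi fun i =>
      Set.Ico (gridLeft N (t i)) (gridLeft N (t i) + 1 / (N + 1))) := fun t =>
    MeasurableSet.univ_pi fun _ => measurableSet_Ico
  rw [lintegral_finsetSum _ fun t _ => measurable_const.indicator (hms t)]
  refine Finset.sum_congr rfl fun t _ => ?_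
  rw [lintegral_indicator_const (hms t), volume_pi_pi]
  have hN : ENNReal.ofReal (1 / ((N : ℝ) + 1)) = ((N : ℝ≥0∞) + 1)⁻¹ := by
    rw [one_div, ENNReal.ofReal_inv_of_pos (by positivity)]
    congr 1
    rw [ENNReal.ofReal_add (by positivity) zero_le_one, ENNReal.ofReal_natCast, ENNReal.ofReal_one]
  simp only [Real.volume_Ico, add_sub_cancel_left, hN, Finset.prod_const, Finset.card_univ,
    Fintype.card_fin]
  rw [mul_assoc, ← mul_pow, ENNReal.mul_inv_cancel (by simp) (by finiteness), one_pow, mul_one]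

/-- The lower bounds for the intensities make the integrals of the step functions lower bounds for
the probability that the ranking lies in `G`. -/
theorem lintegral_gridDensity_le_liminf {Ω : ℕ → Type*} [∀ n, MeasurableSpace (Ω n)]
    {P : ∀ n, Measure (Ω n)} {θ α β : ℝ} {A : ∀ n, Ω n → UnitMultiset}
    (hA : ∀ n, Measurable (A n)) (hT : ∀ n, ∀ᵐ ω ∂(P n), (A n ω).sum ≤ 1)
    {G : Set (ℕ → ℝ)} (hG : IsOpen G) {k : ℕ}
    (h : ∀ a b : Fin k → ℝ, (∀ i, 0 < a i ∧ a i ≤ b i ∧ b i ≤ 1) →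
      Pairwise (fun i j => Disjoint (Set.Icc (a i) (b i)) (Set.Icc (a j) (b j))) →
      ∑ i, b i < 1 → ENNReal.ofReal (tupleBound θ α β a b) ≤
        liminf (fun n => ∫⁻ ω, ∏ i, (A n ω).count (Set.Icc (a i) (b i)) ∂(P n)) atTop) (N : ℕ) :
    ∫⁻ x, gridDensity θ α β G k N x ≤
      liminf (fun n => P n {ω | (A n ω).ranked ∈ G}) atTop := by
  rw [lintegral_gridDensity]
  calc _ ≤ ∑ t ∈ forcingTuples G k N, tupleWeight t * liminf (fun n => ∫⁻ ω, ∏ i,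
          (A n ω).count (Set.Icc (gridLeft N (t i)) (gridRight N (t i))) ∂(P n)) atTop := by
        refine Finset.sum_le_sum fun t ht => ?_
        obtain ⟨hinj, hpos, hsum, -⟩ := mem_forcingTuples.1 ht
        gcongr
        exact h _ _ (fun i => ⟨hpos i, gridLeft_le_gridRight N _, gridRight_le_one N _⟩)
          (fun i j hij => pairwise_disjoint_gridCells N (hinj.ne hij)) hsum
    _ ≤ liminf (fun n => ∑ t ∈ forcingTuples G k N, tupleWeight t * ∫⁻ ω, ∏ i,
          (A n ω).count (Set.Icc (gridLeft N (t i)) (gridRight N (t i))) ∂(P n)) atTop :=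
        sum_mul_liminf_le _ _ _
    _ ≤ _ := by
        refine liminf_le_liminf (.of_forall fun n => ?_)
        exact sum_weight_mul_lintegral_le (hA n) (hT n) hG k N

/-- The index of the grid cell that contains `y`. -/
noncomputable def gridIndex (N : ℕ) (y : Set.Ico (0 : ℝ) 1) : Fin (N + 1) :=
  ⟨⌊y.1 * (N + 1)⌋₊, by
    rw [Nat.floor_lt (mul_nonneg y.2.1 (by positivity))]
    push_cast
    have := y.2.2
    have : (0 : ℝ) < N + 1 := by positivity
    nlinarith⟩

theorem gridLeft_gridIndex_le (N : ℕ) (y : Set.Ico (0 : ℝ) 1) :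
    gridLeft N (gridIndex N y) ≤ y := by
  rw [gridLeft, div_le_iff₀ (by positivity)]
  exact Nat.floor_le (mul_nonneg y.2.1 (by positivity))

theorem lt_gridLeft_gridIndex_add (N : ℕ) (y : Set.Ico (0 : ℝ) 1) :
    (y : ℝ) < gridLeft N (gridIndex N y) + 1 / (N + 1) := by
  rw [gridLeft, ← add_div, lt_div_iff₀ (by positivity)]
  exact Nat.lt_floor_add_one _

theorem tendsto_gridLeft_gridIndex (y : Set.Ico (0 : ℝ) 1) :
    Tendsto (fun N => gridLeft N (gridIndex N y)) atTop (𝓝 y) := by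
  have h := tendsto_one_div_add_atTop_nhds_zero_nat (𝕜 := ℝ)
  refine tendsto_of_tendsto_of_tendsto_of_le_of_le (g := fun N : ℕ => (y : ℝ) - 1 / (N + 1))
    (by simpa using h.const_sub (y : ℝ)) tendsto_const_nhds (fun N => ?_)
    fun N => gridLeft_gridIndex_le N y
  linarith [lt_gridLeft_gridIndex_add N y]

theorem tendsto_gridRight_gridIndex (y : Set.Ico (0 : ℝ) 1) :
    Tendsto (fun N => gridRight N (gridIndex N y)) atTop (𝓝 y) := by
  have h := (tendsto_gridLeft_gridIndex y).add (tendsto_one_div_add_atTop_nhds_zero_nat (𝕜 := ℝ))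
  rw [add_zero] at h
  exact tendsto_of_tendsto_of_tendsto_of_le_of_le (tendsto_gridLeft_gridIndex y) h
    (fun N => gridLeft_le_gridRight N _) fun N => (gridRight_lt N _).le

/-- The tuple of grid cells of a point is eventually one that forces the ranking to lie in `G`, if
this is what elements close to the coordinates of the point do. -/
theorem eventually_gridIndex_mem_forcingTuples {G : Set (ℕ → ℝ)} {k : ℕ}
    {x : Fin k → Set.Ico (0 : ℝ) 1} (hpos : ∀ i, 0 < (x i : ℝ)) (hsum : ∑ i, (x i : ℝ) < 1)
    (hinj : Function.Injective x) {η : ℝ} (hη : 0 < η)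
    (hG : ∀ (A : UnitMultiset) (z : Fin k → ℝ), A.sum ≤ 1 → Function.Injective z →
      (∀ l, A.mult (z l) ≠ 0) → (∀ l, |z l - x l| ≤ η) → A.ranked ∈ G) :
    ∀ᶠ N in atTop, (fun i => gridIndex N (x i)) ∈ forcingTuples G k N := by
  have h1 : ∀ᶠ N in atTop, ∀ i, 0 < gridLeft N (gridIndex N (x i)) :=
    eventually_all.2 fun i => (tendsto_gridLeft_gridIndex (x i)).eventually_const_lt (hpos i)
  have h2 : ∀ᶠ N in atTop, ∑ i, gridRight N (gridIndex N (x i)) < 1 :=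
    (tendsto_finsetSum Finset.univ fun i _ =>
      tendsto_gridRight_gridIndex (x i)).eventually_lt_const hsum
  have h3 : ∀ᶠ N in atTop, ∀ i j, i ≠ j → gridIndex N (x i) ≠ gridIndex N (x j) := by
    refine eventually_all.2 fun i => eventually_all.2 fun j => ?_
    by_cases hij : i = j
    · exact .of_forall fun N h => absurd hij h
    · have hne : (x i : ℝ) - x j ≠ 0 := sub_ne_zero.2 fun h => hij (hinj (Subtype.ext h))
      filter_upwards [((tendsto_gridLeft_gridIndex (x i)).sub
        (tendsto_gridLeft_gridIndex (x j))).eventually_ne hne] with N hN _ heq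
      rw [heq, sub_self] at hN
      exact hN rfl
  have h4 : ∀ᶠ N : ℕ in atTop, 1 / ((N : ℝ) + 1) < η :=
    (tendsto_one_div_add_atTop_nhds_zero_nat (𝕜 := ℝ)).eventually_lt_const hη
  filter_upwards [h1, h2, h3, h4] with N hN1 hN2 hN3 hN4
  have hinjN : Function.Injective fun i => gridIndex N (x i) := fun i j hij => by
    by_contra hne
    exact hN3 i j hne hij
  refine mem_forcingTuples.2 ⟨hinjN, hN1, hN2, fun A hA hcount => ?_⟩
  -- One element is picked in each cell; it is within one mesh width of the matching coordinate, and
  -- disjointness of the cells makes the elements distinct.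
  choose z hz hm using fun i => UnitMultiset.exists_mem_of_count_ne_zero (hcount i)
  refine hG A z hA (fun i j hij => ?_) hm fun l => ?_
  · by_contra hne
    have hd := pairwise_disjoint_gridCells N (hinjN.ne hne)
    exact Set.disjoint_left.1 hd (hz i) (hij ▸ hz j)
  · have e1 := gridLeft_gridIndex_le N (x l)
    have e2 := lt_gridLeft_gridIndex_add N (x l)
    have e3 := gridRight_lt N (gridIndex N (x l))
    have e4 := (hz l).1
    have e5 := (hz l).2
    rw [abs_le]
    constructor <;> linarith

theorem tendsto_precedingSum {ι : Type*} {l : Filter ι} {k : ℕ} {f : ι → Fin k → ℝ}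
    {x : Fin k → ℝ} (h : ∀ i, Tendsto (fun n => f n i) l (𝓝 (x i))) (i : Fin k) :
    Tendsto (fun n => precedingSum (f n) i) l (𝓝 (precedingSum x i)) := by
  refine tendsto_finsetSum _ fun j _ => ?_
  split_ifs
  · exact h j
  · exact tendsto_const_nhds

/-- Both endpoints of the cells converge to the coordinates. The left endpoints in the weight cancel
the right endpoints in the bound, each cell width times `N + 1` tends to 1, and the two powers merge
into the exponent `-(α + β) = θ - 1`. -/
theorem tendsto_weighted_tupleBound {θ α β : ℝ} (hαβ : α + β = 1 - θ) {k : ℕ}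
    {x : Fin k → Set.Ico (0 : ℝ) 1} (hpos : ∀ i, 0 < (x i : ℝ)) (hsum : ∑ i, (x i : ℝ) < 1) :
    Tendsto (fun N : ℕ => (∏ i, gridLeft N (gridIndex N (x i)) /
        (1 - precedingSum (fun i => gridLeft N (gridIndex N (x i))) i)) *
      tupleBound θ α β (fun i => gridLeft N (gridIndex N (x i)))
        (fun i => gridRight N (gridIndex N (x i))) * ((N : ℝ) + 1) ^ k) atTop
      (𝓝 (θ ^ k * (1 - ∑ i, (x i : ℝ)) ^ (θ - 1) *
        ∏ i, (1 - precedingSum (fun i => (x i : ℝ)) i)⁻¹)) := by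
  have hr : 0 < 1 - ∑ i, (x i : ℝ) := by linarith
  have hpre : ∀ i, 1 - precedingSum (fun i => (x i : ℝ)) i ≠ 0 := fun i => by
    have := precedingSum_le_sum (x := fun i => (x i : ℝ)) (fun i => (hpos i).le) i
    linarith
  have hL := fun i => tendsto_gridLeft_gridIndex (x i)
  have hR := fun i => tendsto_gridRight_gridIndex (x i)
  have hmesh : Tendsto (fun N : ℕ => (N : ℝ) / (N + 1)) atTop (𝓝 1) :=
    tendsto_natCast_div_add_atTop 1
  have hlim : Tendsto (fun N : ℕ => θ ^ k / ((1 - ∑ i, gridLeft N (gridIndex N (x i))) ^ α *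
        (1 - ∑ i, gridRight N (gridIndex N (x i))) ^ β) *
      ∏ i, (gridLeft N (gridIndex N (x i)) /
        (1 - precedingSum (fun i => gridLeft N (gridIndex N (x i))) i) *
        ((N : ℝ) / (N + 1) / gridRight N (gridIndex N (x i))))) atTop
      (𝓝 (θ ^ k / ((1 - ∑ i, (x i : ℝ)) ^ α * (1 - ∑ i, (x i : ℝ)) ^ β) *
        ∏ i, (x i / (1 - precedingSum (fun i => (x i : ℝ)) i) * (1 / (x i : ℝ))))) := by
    refine Tendsto.mul (Tendsto.div tendsto_const_nhds (Tendsto.mul ?_ ?_) ?_)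
      (tendsto_finsetProd _ fun i _ => Tendsto.mul ?_ ?_)
    · exact ((tendsto_finsetSum _ fun i _ => hL i).const_sub 1).rpow_const (Or.inl hr.ne')
    · exact ((tendsto_finsetSum _ fun i _ => hR i).const_sub 1).rpow_const (Or.inl hr.ne')
    · exact (mul_pos (Real.rpow_pos_of_pos hr _) (Real.rpow_pos_of_pos hr _)).ne'
    · exact (hL i).div ((tendsto_precedingSum hL i).const_sub 1) (hpre i)
    · exact hmesh.div (hR i) (hpos i).ne'
  convert hlim using 1
  · ext N
    rw [tupleBound, Finset.prod_mul_distrib]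
    have : ∏ i, ((N : ℝ) / (N + 1) / gridRight N (gridIndex N (x i))) =
        (∏ i, (gridRight N (gridIndex N (x i)) - gridLeft N (gridIndex N (x i))) /
          gridRight N (gridIndex N (x i))) * ((N : ℝ) + 1) ^ k := by
      rw [← Fin.prod_const, ← Finset.prod_mul_distrib]
      refine Finset.prod_congr rfl fun i _ => ?_
      have : gridRight N (gridIndex N (x i)) - gridLeft N (gridIndex N (x i)) =
          (N : ℝ) / (N + 1) / (N + 1) := by
        rw [gridRight]
        ring
      rw [this]
      field_simp
    rw [this]
    ring
  · congr 2
    · rw [← Real.rpow_add hr, hαβ, div_eq_mul_inv, ← Real.rpow_neg hr.le]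
      congr 2
      ring
    · refine Finset.prod_congr rfl fun i _ => ?_
      have := (hpos i).ne'
      field_simp

/-- The step functions are asymptotically at least the density. -/
theorem gemDensity_le_liminf_gridDensity {θ α β : ℝ} (hαβ : α + β = 1 - θ)
    {G : Set (ℕ → ℝ)} {k : ℕ} {x : Fin k → Set.Ico (0 : ℝ) 1} (hpos : ∀ i, 0 < (x i : ℝ))
    (hsum : ∑ i, (x i : ℝ) < 1) (hinj : Function.Injective x) {η : ℝ} (hη : 0 < η)
    (hG : ∀ (A : UnitMultiset) (z : Fin k → ℝ), A.sum ≤ 1 → Function.Injective z →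
      (∀ l, A.mult (z l) ≠ 0) → (∀ l, |z l - x l| ≤ η) → A.ranked ∈ G) :
    gemDensity θ k (fun i => x i) ≤
      liminf (fun N => gridDensity θ α β G k N (fun i => x i)) atTop := by
  have hmem : (fun i => (x i : ℝ)) ∈ {x : Fin k → ℝ | (∀ i, 0 < x i) ∧ ∑ i, x i < 1} :=
    ⟨hpos, hsum⟩
  rw [gemDensity, Set.indicator_of_mem hmem,
    ← (ENNReal.tendsto_ofReal (tendsto_weighted_tupleBound hαβ hpos hsum)).liminf_eq]
  refine liminf_le_liminf ?_
  filter_upwards [eventually_gridIndex_mem_forcingTuples hpos hsum hinj hη hG] with N hN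
  obtain ⟨-, hLpos, hRsum, -⟩ := mem_forcingTuples.1 hN
  have hLsum : ∑ i, gridLeft N (gridIndex N (x i)) < 1 :=
    (Finset.sum_le_sum fun i _ => gridLeft_le_gridRight N _).trans_lt hRsum
  have hw : ∀ i, 0 ≤ gridLeft N (gridIndex N (x i)) /
      (1 - precedingSum (fun i => gridLeft N (gridIndex N (x i))) i) := fun i => by
    have := precedingSum_le_sum (x := fun i => gridLeft N (gridIndex N (x i)))
      (fun i => (hLpos i).le) i
    exact div_nonneg (hLpos i).le (by linarith)
  rw [ENNReal.ofReal_mul' (by positivity), ENNReal.ofReal_mul (Finset.prod_nonneg fun i _ => hw i),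
    ENNReal.ofReal_prod_of_nonneg fun i _ => hw i, ENNReal.ofReal_pow (by positivity),
    ENNReal.ofReal_add (by positivity) zero_le_one, ENNReal.ofReal_natCast, ENNReal.ofReal_one,
    gridDensity]
  -- Only the tuple of cells containing the point is kept from the sum.
  refine le_trans ?_ (Finset.single_le_sum (fun _ _ => zero_le) hN)
  rw [Set.indicator_of_mem]
  · rfl
  · exact fun i _ => ⟨gridLeft_gridIndex_le N (x i), lt_gridLeft_gridIndex_add N (x i)⟩

/-! ### Passage to the limit and conclusion -/

/-- Lower bounds for the integrals of the step functions bound the probabilities of open sets under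
the Poisson-Dirichlet distribution. -/
theorem poissonDirichlet_le_of_lintegral_gridDensity_le {θ α β : ℝ} (hθ : 0 < θ)
    (hαβ : α + β = 1 - θ) {G : Set (ℕ → ℝ)} (hG : IsOpen G) {p : ℝ≥0∞}
    (hp : ∀ k, 1 ≤ k → ∀ N, ∫⁻ x, gridDensity θ α β G k N x ≤ p) :
    poissonDirichlet θ G ≤ p := by
  set E : ℕ → Set (ℕ → ℝ) := fun k => {u | gemDensity θ k (fun i => gemSeq θ u i) ≤
    liminf (fun N => gridDensity θ α β G k N fun i => gemSeq θ u i) atTop} with hE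
  have hK : ∀ k, MeasurableSet {x : Fin k → ℝ | gemDensity θ k x ≤
      liminf (fun N => gridDensity θ α β G k N x) atTop} := fun k =>
    measurableSet_le (measurable_gemDensity θ k)
      (.liminf fun N => measurable_gridDensity θ α β G k N)
  have hEm : ∀ k, MeasurableSet (E k) := fun k => measurable_gemSeq_fin θ k (hK k)
  -- On `E k` the density is at most the liminf of the step functions, so Fatou's lemma in the mesh
  -- bounds its integral by `p`.
  have hbound : ∀ k, 1 ≤ k → uniformSeqLaw (E k) ≤ p := by
    intro k hk
    have : uniformSeqLaw (E k) = volume.withDensity (gemDensity θ k) {x : Fin k → ℝ |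
        gemDensity θ k x ≤ liminf (fun N => gridDensity θ α β G k N x) atTop} := by
      rw [← uniformSeqLaw_map_gemSeq hθ, Measure.map_apply (measurable_gemSeq_fin θ k) (hK k)]
      rfl
    rw [this, withDensity_apply _ (hK k)]
    calc _ ≤ ∫⁻ x in {x : Fin k → ℝ | gemDensity θ k x ≤
            liminf (fun N => gridDensity θ α β G k N x) atTop},
            liminf (fun N => gridDensity θ α β G k N x) atTop := setLIntegral_mono'
              (hK k) fun x hx => hx
      _ ≤ ∫⁻ x, liminf (fun N => gridDensity θ α β G k N x) atTop := setLIntegral_le_lintegral _ _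
      _ ≤ liminf (fun N => ∫⁻ x, gridDensity θ α β G k N x) atTop :=
          lintegral_liminf_le fun N => measurable_gridDensity θ α β G k N
      _ ≤ p := liminf_le_of_le (by isBoundedDefault) fun b hb => by
          obtain ⟨N, hN⟩ := hb.exists
          exact hN.trans (hp k hk N)
  have hmeas : Measurable fun u => rankedSeq (gemSeq θ u) :=
    measurable_rankedSeq.comp (measurable_gemSeq θ)
  -- If the ranking lies in `G`, long initial segments almost surely force this, so `u` belongs to
  -- `E k` for all large `k`; Fatou's lemma in `k` then concludes.
  have hev : ∀ᵐ u ∂uniformSeqLaw, rankedSeq (gemSeq θ u) ∈ G → ∀ᶠ k in atTop, u ∈ E k := by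
    filter_upwards [ae_gemSeq hθ] with u ⟨hinj, hpos, hlt, hlim⟩ hu
    filter_upwards [eventually_ranked_mem hG hpos hlt hlim hu] with k ⟨η, hη, hk⟩
    have hlt1 : ∀ i : Fin k, gemSeq θ u i < 1 := fun i =>
      (Finset.single_le_sum (f := fun i : Fin k => gemSeq θ u i) (fun j _ => (hpos j).le)
        (Finset.mem_univ i)).trans_lt (hlt k)
    exact gemDensity_le_liminf_gridDensity (x := fun i => ⟨gemSeq θ u i, (hpos i).le, hlt1 i⟩)
      hαβ (fun i => hpos i) (hlt k)
      (fun i j hij => Fin.ext (hinj (congrArg Subtype.val hij))) hη hk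
  rw [poissonDirichlet, Measure.map_apply hmeas hG.measurableSet,
    ← lintegral_indicator_one (hmeas hG.measurableSet)]
  calc _ ≤ ∫⁻ u, liminf (fun k => (E k).indicator 1 u) atTop ∂uniformSeqLaw := by
        refine lintegral_mono_ae (hev.mono fun u hu => ?_)
        by_cases hmem : u ∈ (fun u => rankedSeq (gemSeq θ u)) ⁻¹' G
        · rw [Set.indicator_of_mem hmem]
          refine le_liminf_of_le (by isBoundedDefault) ((hu hmem).mono fun k hk => ?_)
          rw [Set.indicator_of_mem hk]
        · rw [Set.indicator_of_notMem hmem]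
          exact zero_le
    _ ≤ liminf (fun k => ∫⁻ u, (E k).indicator 1 u ∂uniformSeqLaw) atTop :=
        lintegral_liminf_le fun k => measurable_one.indicator (hEm k)
    _ ≤ p := by
        refine liminf_le_of_le (by isBoundedDefault) fun b hb => ?_
        -- The hypothesis covers only `k ≥ 1`, which is harmless along `k → ∞`.
        obtain ⟨k, hk, hk1⟩ := (hb.and (eventually_ge_atTop 1)).exists
        refine hk.trans ?_
        rw [lintegral_indicator_one (hEm k)]
        exact hbound k hk1

/-- The inequality `1 - 1 / x ≤ log x` at `x = b i / a i`; it reduces the logarithmic hypothesis to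
the other one. -/
theorem tupleBound_le_log {θ α β : ℝ} (hθ : 0 < θ) {k : ℕ} {a b : Fin k → ℝ}
    (hab : ∀ i, 0 < a i ∧ a i ≤ b i ∧ b i ≤ 1) (hsum : ∑ i, b i < 1) :
    tupleBound θ α β a b ≤ θ ^ k / ((1 - ∑ i, a i) ^ α * (1 - ∑ i, b i) ^ β) *
      ∏ i, Real.log (b i / a i) := by
  have ha : ∑ i, a i ≤ ∑ i, b i := Finset.sum_le_sum fun i _ => (hab i).2.1
  have h1 : 0 < (1 - ∑ i, a i) ^ α := Real.rpow_pos_of_pos (by linarith) _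
  have h2 : 0 < (1 - ∑ i, b i) ^ β := Real.rpow_pos_of_pos (by linarith) _
  refine mul_le_mul_of_nonneg_left (Finset.prod_le_prod (fun i _ => ?_) fun i _ => ?_)
    (by positivity)
  · obtain ⟨h3, h4, -⟩ := hab i
    exact div_nonneg (by linarith) (by linarith)
  · obtain ⟨h3, h4, -⟩ := hab i
    have hb : 0 < b i := by linarith
    have h5 := Real.one_sub_inv_le_log_of_pos (div_pos hb h3)
    rwa [inv_div, one_sub_div hb.ne'] at h5

theorem lemma3p2 {Ω : ℕ → Type*} [∀ n, MeasurableSpace (Ω n)]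
    (P : ∀ n, Measure (Ω n)) [∀ n, IsProbabilityMeasure (P n)]
    (θ : ℝ) (hθ : 0 < θ)
    (A : ∀ n, Ω n → UnitMultiset) (hA : ∀ n, Measurable (A n))
    (hT : ∀ n, ∀ᵐ ω ∂(P n), (A n ω).sum ≤ 1)
    (α β : ℝ) (hαβ : α + β = 1 - θ)
    (h :
      (∀ k : ℕ, 1 ≤ k → ∀ a b : Fin k → ℝ,
        (∀ i, 0 < a i ∧ a i ≤ b i ∧ b i ≤ 1) →
        Pairwise (fun i j => Disjoint (Set.Icc (a i) (b i)) (Set.Icc (a j) (b j))) →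
        ∑ i, b i < 1 →
        ENNReal.ofReal (θ ^ k / ((1 - ∑ i, a i) ^ α * (1 - ∑ i, b i) ^ β) *
            ∏ i, (b i - a i) / b i) ≤
          liminf (fun n => ∫⁻ ω, ∏ i, (A n ω).count (Set.Icc (a i) (b i)) ∂(P n)) atTop) ∨
      (∀ k : ℕ, 1 ≤ k → ∀ a b : Fin k → ℝ,
        (∀ i, 0 < a i ∧ a i ≤ b i ∧ b i ≤ 1) →
        Pairwise (fun i j => Disjoint (Set.Icc (a i) (b i)) (Set.Icc (a j) (b j))) →
        ∑ i, b i < 1 →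
        ENNReal.ofReal (θ ^ k / ((1 - ∑ i, a i) ^ α * (1 - ∑ i, b i) ^ β) *
            ∏ i, Real.log (b i / a i)) ≤
          liminf (fun n => ∫⁻ ω, ∏ i, (A n ω).count (Set.Icc (a i) (b i)) ∂(P n)) atTop)) :
    TendstoInDistribution (fun n ω => (A n ω).ranked) atTop (id : (ℕ → ℝ) → ℕ → ℝ)
      P (poissonDirichlet θ) := by
  have h' : ∀ k : ℕ, 1 ≤ k → ∀ a b : Fin k → ℝ, (∀ i, 0 < a i ∧ a i ≤ b i ∧ b i ≤ 1) →
      Pairwise (fun i j => Disjoint (Set.Icc (a i) (b i)) (Set.Icc (a j) (b j))) →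
      ∑ i, b i < 1 → ENNReal.ofReal (tupleBound θ α β a b) ≤
        liminf (fun n => ∫⁻ ω, ∏ i, (A n ω).count (Set.Icc (a i) (b i)) ∂(P n)) atTop := by
    rcases h with h | h
    · exact h
    · intro k hk a b hab hdis hsum
      exact (ENNReal.ofReal_le_ofReal (tupleBound_le_log hθ hab hsum)).trans
        (h k hk a b hab hdis hsum)
  have hm : ∀ n, Measurable fun ω => (A n ω).ranked := fun n =>
    UnitMultiset.measurable_ranked.comp (hA n)
  -- Portmanteau theorem, in the form that asks for lower bounds on open sets.
  refine ⟨fun n => (hm n).aemeasurable, aemeasurable_id,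
    tendsto_of_forall_isOpen_le_liminf_nat' fun G hG => ?_⟩
  simp only [ProbabilityMeasure.coe_mk, Measure.map_id, Measure.map_apply (hm _) hG.measurableSet]
  exact poissonDirichlet_le_of_lintegral_gridDensity_le hθ hαβ hG fun k hk N =>
    lintegral_gridDensity_le_liminf hA hT hG (h' k hk) N
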